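/- Let $n\ge 1$, $0<s<1$, $1<p<\infty$, $p'=p/(p-1)$, let $\Omega\subset\mathbb R^n$ be a bounded open set, and let $0<\lambda\le\Lambda<\infty$. For $u:\mathbb R^n\to\mathbb R$ put $D_{s,p}u(x,y)=\dfrac{u(x)-u(y)}{|x-y|^{n/p+s}}$. Let $W^{s,p}(\mathbb R^n)=\{u\in L^p(\mathbb R^n): D_{s,p}u\in L^p(\mathbb R^n\times\mathbb R^n)\}$ with norm $\|u\|_{s,p}=(\|u\|_p^p+\|D_{s,p}u\|_p^p)^{1/p}$, and let $W^{s,p}_0(\Omega)$ be the closure of $C_c^\infty(\Omega)$ in $W^{s,p}(\mathbb R^n)$. (If $\Omega$ has Lipschitz boundary, this is the space of all $u\in W^{s,p}(\mathbb R^n)$ with $u=0$ a.e. outside $\Omega$.) Let $$\mathcal A_{\lambda,\Lambda}=\{a\in L^\infty(\mathbb R^n\times\mathbb R^n): a(x,y)=a(y,x),\ \lambda\le a(x,y)\le\Lambda \text{ a.e. in } \mathbb R^n\times\mathbb R^n\}.$$ For $a\in\mathcal A_{\lambda,\Lambda}$ and $f$ in the dual space of $W^{s,p}_0(\Omega)$,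 a weak solution of $\mathcal L_a u=f$ in $\Omega$, $u=0$ in $\mathbb R^n\setminus\Omega$, is a $u\in W^{s,p}_0(\Omega)$ such that for all $v\in C_c^\infty(\Omega)$ $$\frac12\iint_{\mathbb R^n\times\mathbb R^n}a(x,y)\frac{|u(x)-u(y)|^{p-2}(u(x)-u(y))(v(x)-v(y))}{|x-y|^{n+sp}}\,dx\,dy=\langle f,v\rangle .$$ Its flux is $q=a|D_{s,p}u|^{p-2}D_{s,p}u$. One says that $\mathcal L_{a_k}$ $H$-converges to $\mathcal L_a$ if for every $f$ in the dual of $W^{s,p}_0(\Omega)$ the problems with coefficients $a_k$ and $a$ have unique weak solutions $u_k$ and $u$, $u_k\rightharpoonup u$ weakly in $W^{s,p}_0(\Omega)$, and the fluxes satisfy $q_k\rightharpoonup q$ weakly in $L^{p'}(\Omega\times\Omega)$. **Theorem.** For every sequence $(a_k)$ in $\mathcal A_{\lambda,\Lambda}$ there are a subsequence $(a_{k'})$ and a coefficient $a$ in the same class $\mathcal A_{\lambda,\Lambda}$ (so $\lambda\le a\le\Lambda$ a.e. in $\mathbb R^n\times\mathbb R^n$) such that $\mathcal L_{a_{k'}}$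 $H$-converges to $\mathcal L_a$. Moreover, the fluxes then converge weakly even in $L^{p'}(\mathbb R^n\times\mathbb R^n)$. -/

import Mathlib

open MeasureTheory Filter Topology
open scoped ENNReal ContDiff

instance factOneLeOfReal (p : ℝ) [hp : Fact (1 < p)] : Fact (1 ≤ ENNReal.ofReal p) :=
  ⟨by simpa using hp.out.le⟩

/-- The Euclidean space `ℝⁿ`. -/
abbrev Rn (n : ℕ) : Type := EuclideanSpace ℝ (Fin n)

/-- The `(s,p)`-nonlocal gradient `D_{s,p} u (x,y) = (u x - u y) / |x - y| ^ (n / p + s)`. -/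
noncomputable def nlGrad (n : ℕ) (s p : ℝ) (u : Rn n → ℝ) (z : Rn n × Rn n) : ℝ :=
  (u z.1 - u z.2) / ‖z.1 - z.2‖ ^ ((n : ℝ) / p + s)

theorem nlGrad_add (n : ℕ) (s p : ℝ) (u v : Rn n → ℝ) :
    nlGrad n s p (u + v) = nlGrad n s p u + nlGrad n s p v := by
  funext z
  simp only [nlGrad, Pi.add_apply]
  ring

theorem nlGrad_smul (n : ℕ) (s p : ℝ) (c : ℝ) (u : Rn n → ℝ) :
    nlGrad n s p (c • u) = c • nlGrad n s p u := by
  funext z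
  simp only [nlGrad, Pi.smul_apply, smul_eq_mul]
  ring

/-- The nonlocal gradient depends only on the almost everywhere class of the function. -/
theorem nlGrad_congr (n : ℕ) (s p : ℝ) {u v : Rn n → ℝ}
    (h : u =ᵐ[volume] v) : nlGrad n s p u =ᵐ[volume] nlGrad n s p v := by
  have h1 : ∀ᵐ z : Rn n × Rn n, u z.1 = v z.1 :=
    Measure.quasiMeasurePreserving_fst.ae h
  have h2 : ∀ᵐ z : Rn n × Rn n, u z.2 = v z.2 :=
    Measure.quasiMeasurePreserving_snd.ae h
  filter_upwards [h1, h2] with z hz1 hz2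
  simp only [nlGrad, hz1, hz2]

/-- The space `L^p(ℝⁿ) × L^p(ℝⁿ × ℝⁿ)` with the norm `(‖g‖_p ^ p + ‖G‖_p ^ p) ^ (1 / p)`. -/
abbrev LpPair (n : ℕ) (p : ℝ) : Type :=
  WithLp (ENNReal.ofReal p)
    (Lp ℝ (ENNReal.ofReal p) (volume : Measure (Rn n)) ×
      Lp ℝ (ENNReal.ofReal p) (volume : Measure (Rn n × Rn n)))

/-- The fractional Sobolev space `W^{s,p}(ℝⁿ)` of all `u ∈ L^p(ℝⁿ)` with
`D_{s,p} u ∈ L^p(ℝⁿ × ℝⁿ)`. The function `u` is stored together with its nonlocal gradient, as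
the pair `(u, D_{s,p} u)`, so that the norm inherited from `LpPair` is
`‖u‖_{s,p} = (‖u‖_p ^ p + |u|_{s,p} ^ p) ^ (1 / p)`. -/
noncomputable def Wsp (n : ℕ) (s p : ℝ) [Fact (1 < p)] : Submodule ℝ (LpPair n p) where
  carrier := {w | (w.snd : Rn n × Rn n → ℝ) =ᵐ[volume] nlGrad n s p w.fst}
  zero_mem' := by
    have h0 : nlGrad n s p (0 : Rn n → ℝ) = 0 := by
      funext z
      simp [nlGrad]
    have h := nlGrad_congr n s p
      (Lp.coeFn_zero ℝ (ENNReal.ofReal p) (volume : Measure (Rn n)))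
    rw [h0] at h
    exact (Lp.coeFn_zero ℝ (ENNReal.ofReal p) (volume : Measure (Rn n × Rn n))).trans h.symm
  add_mem' := by
    intro v w hv hw
    have h := nlGrad_congr n s p (Lp.coeFn_add v.fst w.fst)
    rw [nlGrad_add] at h
    exact (Lp.coeFn_add v.snd w.snd).trans ((Filter.EventuallyEq.add (show _ =ᵐ[volume] _ from hv) hw).trans h.symm)
  smul_mem' := by
    intro c w hw
    have h := nlGrad_congr n s p (Lp.coeFn_smul c w.fst)
    rw [nlGrad_smul] at h
    exact (Lp.coeFn_smul c w.snd).trans ((Filter.EventuallyEq.const_smul (show _ =ᵐ[volume] _ from hw) c).trans h.symm)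

/-- The function underlying an element of `W^{s,p}(ℝⁿ)`. -/
noncomputable def wspFn {n : ℕ} {s p : ℝ} [Fact (1 < p)] (w : Wsp n s p) : Rn n → ℝ :=
  (w : LpPair n p).fst

/-- A function `u ∈ L^p(ℝⁿ)` with `D_{s,p} u ∈ L^p(ℝⁿ × ℝⁿ)`, as an element of `W^{s,p}(ℝⁿ)`. -/
noncomputable def wspMk {n : ℕ} {s p : ℝ} [Fact (1 < p)] (u : Rn n → ℝ)
    (hu : MemLp u (ENNReal.ofReal p) volume)
    (hD : MemLp (nlGrad n s p u) (ENNReal.ofReal p) volume) : Wsp n s p :=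
  ⟨WithLp.toLp _ (hu.toLp u, hD.toLp _),
    hD.coeFn_toLp.trans (nlGrad_congr n s p hu.coeFn_toLp).symm⟩

theorem wspFn_mk {n : ℕ} {s p : ℝ} [Fact (1 < p)] (u : Rn n → ℝ)
    (hu : MemLp u (ENNReal.ofReal p) volume)
    (hD : MemLp (nlGrad n s p u) (ENNReal.ofReal p) volume) :
    wspFn (wspMk u hu hD) =ᵐ[volume] u :=
  hu.coeFn_toLp

/-- An element of `W^{s,p}(ℝⁿ)` is determined by its underlying function. -/
theorem wsp_ext {n : ℕ} {s p : ℝ} [Fact (1 < p)] {v w : Wsp n s p}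
    (h : wspFn v =ᵐ[volume] wspFn w) : v = w := by
  apply Subtype.ext
  apply (WithLp.equiv _ _).injective
  refine Prod.ext (Lp.ext h) (Lp.ext ?_)
  have hv : (v.1.snd : Rn n × Rn n → ℝ) =ᵐ[volume] nlGrad n s p v.1.fst := v.2
  have hw : (w.1.snd : Rn n × Rn n → ℝ) =ᵐ[volume] nlGrad n s p w.1.fst := w.2
  exact hv.trans ((nlGrad_congr n s p h).trans hw.symm)

/-- The subspace of `W^{s,p}(ℝⁿ)` formed by the test functions `C_c^∞(Ω)`. -/
noncomputable def testFunctions (n : ℕ) (s p : ℝ) [Fact (1 < p)] (Ω : Set (Rn n)) :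
    Submodule ℝ (Wsp n s p) where
  carrier := {w | ∃ φ : Rn n → ℝ, ContDiff ℝ ∞ φ ∧ HasCompactSupport φ ∧ tsupport φ ⊆ Ω ∧
    wspFn w =ᵐ[volume] φ}
  zero_mem' := by
    refine ⟨0, contDiff_const, HasCompactSupport.zero, ?_, Lp.coeFn_zero _ _ _⟩
    simp [tsupport]
  add_mem' := by
    rintro v w ⟨φ, hφ, hφc, hφs, hv⟩ ⟨ψ, hψ, hψc, hψs, hw⟩
    exact ⟨φ + ψ, hφ.add hψ, hφc.add hψc,
      (tsupport_add φ ψ).trans (Set.union_subset hφs hψs),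
      (Lp.coeFn_add v.1.fst w.1.fst).trans (hv.add hw)⟩
  smul_mem' := by
    rintro c w ⟨φ, hφ, hφc, hφs, hw⟩
    exact ⟨c • φ, contDiff_const.smul hφ, hφc.smul_left (f := fun _ => c),
      (tsupport_smul_subset_right (fun _ => c) φ).trans hφs,
      (Lp.coeFn_smul c w.1.fst).trans (hw.const_smul c)⟩

/-- The space `W_0^{s,p}(Ω)`, the closure of `C_c^∞(Ω)` in `W^{s,p}(ℝⁿ)`. -/
noncomputable def W0 (n : ℕ) (s p : ℝ) [Fact (1 < p)] (Ω : Set (Rn n)) :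
    Submodule ℝ (Wsp n s p) :=
  (testFunctions n s p Ω).topologicalClosure

/-- The class `𝒜_{l,L}` of symmetric conductivities with values in `[l, L]`. -/
def CoeffClass (n : ℕ) (l L : ℝ) : Set (Rn n × Rn n → ℝ) :=
  {a | MemLp a ⊤ volume ∧ (∀ᵐ z, a z = a z.swap) ∧ ∀ᵐ z, l ≤ a z ∧ a z ≤ L}

/-- The nonlocal flux `a |D_{s,p} u| ^ (p - 2) D_{s,p} u`. -/
noncomputable def flux (n : ℕ) (s p : ℝ) (a : Rn n × Rn n → ℝ) (u : Rn n → ℝ)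
    (z : Rn n × Rn n) : ℝ :=
  a z * |nlGrad n s p u z| ^ (p - 2) * nlGrad n s p u z

/-- Weak solutions `u ∈ W_0^{s,p}(Ω)` of `ℒ_a u = f` in `Ω`, `u = 0` outside `Ω`, where `f` lies
in the dual space `W^{-s,p'}(Ω)` of `W_0^{s,p}(Ω)`: for all test functions `v ∈ C_c^∞(Ω)`,
`1/2 ∬ a(x,y) |u(x)-u(y)|^(p-2) (u(x)-u(y)) (v(x)-v(y)) / |x-y|^(n+sp) dx dy = ⟨f, v⟩`. -/
def IsWeakSolution {n : ℕ} {s p : ℝ} [Fact (1 < p)] {Ω : Set (Rn n)}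
    (a : Rn n × Rn n → ℝ) (f : StrongDual ℝ (W0 n s p Ω)) (u : W0 n s p Ω) : Prop :=
  ∀ v : W0 n s p Ω, (v : Wsp n s p) ∈ testFunctions n s p Ω →
    (1 / 2 : ℝ) * ∫ z : Rn n × Rn n,
      a z * |wspFn u.1 z.1 - wspFn u.1 z.2| ^ (p - 2) * (wspFn u.1 z.1 - wspFn u.1 z.2) *
        (wspFn v.1 z.1 - wspFn v.1 z.2) / ‖z.1 - z.2‖ ^ ((n : ℝ) + s * p) = f v

/-- `u` is the one and only weak solution, that is, `(u, flux a u) = 𝒮_a f`. -/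
def IsTheSolution {n : ℕ} {s p : ℝ} [Fact (1 < p)] {Ω : Set (Rn n)}
    (a : Rn n × Rn n → ℝ) (f : StrongDual ℝ (W0 n s p Ω)) (u : W0 n s p Ω) : Prop :=
  ∀ w : W0 n s p Ω, IsWeakSolution a f w ↔ w = u

/-- Weak convergence `q_k ⇀ q` in `L^{p'}(G)`, `p' = p / (p - 1)`, tested against `L^p(G)`. -/
def WeakConvConj {n : ℕ} (p : ℝ) (G : Set (Rn n × Rn n)) (q : ℕ → Rn n × Rn n → ℝ)
    (q' : Rn n × Rn n → ℝ) : Prop :=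
  (∀ k, MemLp (q k) (ENNReal.ofReal (p / (p - 1))) (volume.restrict G)) ∧
  MemLp q' (ENNReal.ofReal (p / (p - 1))) (volume.restrict G) ∧
  ∀ g : Rn n × Rn n → ℝ, MemLp g (ENNReal.ofReal p) (volume.restrict G) →
    Tendsto (fun k => ∫ z in G, q k z * g z) atTop (𝓝 (∫ z in G, q' z * g z))

/-- `H`-convergence of `ℒ_{a_k}` to `ℒ_a`, with weak convergence of the fluxes in `L^{p'}(G)`:
for each `f` in the dual of `W_0^{s,p}(Ω)` the solutions exist and are unique, the states converge
weakly in `W_0^{s,p}(Ω)`, and the fluxes converge weakly in `L^{p'}(G)`. -/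
def HConvergesOn (n : ℕ) (s p : ℝ) [Fact (1 < p)] (Ω : Set (Rn n)) (G : Set (Rn n × Rn n))
    (a : ℕ → Rn n × Rn n → ℝ) (a' : Rn n × Rn n → ℝ) : Prop :=
  ∀ f : StrongDual ℝ (W0 n s p Ω), ∃ (u : ℕ → W0 n s p Ω) (u' : W0 n s p Ω),
    (∀ k, IsTheSolution (a k) f (u k)) ∧ IsTheSolution a' f u' ∧
    (∀ ℓ : StrongDual ℝ (W0 n s p Ω), Tendsto (fun k => ℓ (u k)) atTop (𝓝 (ℓ u'))) ∧
    WeakConvConj p G (fun k => flux n s p (a k) (wspFn (u k).1)) (flux n s p a' (wspFn u'.1))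

/-- `H`-convergence of `ℒ_{a_k}` to `ℒ_a`: the fluxes converge weakly in `L^{p'}(Ω × Ω)`. -/
def HConverges (n : ℕ) (s p : ℝ) [Fact (1 < p)] (Ω : Set (Rn n))
    (a : ℕ → Rn n × Rn n → ℝ) (a' : Rn n × Rn n → ℝ) : Prop :=
  HConvergesOn n s p Ω (Ω ×ˢ Ω) a a'

/-! The `H`-limit is simply the weak-* limit `a'` of a subsequence of the coefficients in `L^∞(ℝⁿ ×
ℝⁿ)`; bounds and symmetry pass to it, so the class is preserved with the same constants. For local
operators this would be false. Here it holds because a nonlocal gradient is, off the diagonal, a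
bounded multiple of `w(x) - w(y)`, and bounded sequences in `W^{s,p}` are precompact in `L^1` of
bounded sets.

Write `J` for `oddPow p`, `D` for the nonlocal gradient and `q = p'`. The key is
`tendsto_integral_mul_nlGrad`: if `b_k` is weak-* null, `G ∈ L^q` is fixed and `w_k` is bounded in
`W^{s,p}`, then `∫ b_k G D w_k → 0`. After truncating `G` to a bounded function supported in a
bounded set away from the diagonal, it remains to treat `∫ b_k H w_k(x)` with `H` bounded and of
bounded support. There `w_k` is replaced by finitely many ball means, with an `L^1` error uniform in
`k`; the means are bounded numbers, and what they multiply are integrals of `b_k` against fixed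
integrable functions.

Let `u_k` and `u'` solve the problems for `a_k` and `a'` with the same `f`. Subtracting the
equations tested with `u_k - u'` gives `∫ a_k (J(D u_k) - J(D u')) D(u_k - u') = -∫ (a_k - a') J(D
u') D(u_k - u')`, whose right side tends to zero by the key lemma. Strict monotonicity of `J` and
`a_k ≥ l > 0` then yield `D u_k → D u'` strongly in `L^p`, and Poincaré's inequality gives `u_k →
u'` in norm. The flux is `a_k (J(D u_k) - J(D u')) + a_k J(D u')`: the first term tends to zero in
`L^q`, the second converges weakly because `a_k` does so weak-*. All this happens on the whole of
`ℝⁿ × ℝⁿ`.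

Existence comes from the direct method. Uniform convexity, strong monotonicity and continuity of `J`
are all obtained, for every `p > 1` at once, from one compactness argument for homogeneous functions
on the plane (`exists_le_add_mul_of_homogeneous`). -/

/-! ### Pointwise inequalities for the odd power. -/

/-- The odd power `x ↦ |x| ^ (p - 2) x`, the derivative of `|x| ^ p / p`. -/
noncomputable def oddPow (p x : ℝ) : ℝ := |x| ^ (p - 2) * x

theorem oddPow_of_nonneg {p : ℝ} (hp : 1 < p) {x : ℝ} (hx : 0 ≤ x) : oddPow p x = x ^ (p - 1) := by
  rcases hx.eq_or_lt with rfl | hx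
  · simp [oddPow, Real.zero_rpow (sub_pos.2 hp).ne']
  · rw [oddPow, abs_of_pos hx, ← Real.rpow_add_one hx.ne']
    ring_nf

theorem oddPow_neg (p x : ℝ) : oddPow p (-x) = -oddPow p x := by
  simp [oddPow]

theorem abs_oddPow {p : ℝ} (hp : 1 < p) (x : ℝ) : |oddPow p x| = |x| ^ (p - 1) := by
  rw [← oddPow_of_nonneg hp (abs_nonneg x), oddPow, oddPow, abs_mul, abs_abs,
    abs_of_nonneg (Real.rpow_nonneg (abs_nonneg x) _)]

theorem oddPow_mul_self {p : ℝ} (hp : 1 < p) (x : ℝ) : oddPow p x * x = |x| ^ p := by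
  have h : oddPow p x * x = oddPow p |x| * |x| := by
    simp only [oddPow, abs_abs, mul_assoc, abs_mul_abs_self]
  rw [h, oddPow_of_nonneg hp (abs_nonneg x)]
  rcases (abs_nonneg x).eq_or_lt with h0 | h0
  · rw [← h0]; simp [Real.zero_rpow (zero_lt_one.trans hp).ne']
  · rw [← Real.rpow_add_one h0.ne', sub_add_cancel]

theorem oddPow_mul {p c : ℝ} (hp : 1 < p) (hc : 0 ≤ c) (x : ℝ) :
    oddPow p (c * x) = c ^ (p - 1) * oddPow p x := by
  rw [← oddPow_of_nonneg hp hc, oddPow, oddPow, oddPow, abs_mul, abs_of_nonneg hc,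
    Real.mul_rpow hc (abs_nonneg x)]
  ring

/-- Only the positive exponent `p - 1` occurs here, so continuity at `0` is visible even for `p <
2`, where `|x| ^ (p - 2)` is singular. -/
theorem oddPow_eq_max {p : ℝ} (hp : 1 < p) (x : ℝ) :
    oddPow p x = max x 0 ^ (p - 1) - max (-x) 0 ^ (p - 1) := by
  have h0 : (0 : ℝ) ^ (p - 1) = 0 := Real.zero_rpow (sub_pos.2 hp).ne'
  rcases le_total 0 x with hx | hx
  · rw [max_eq_left hx, max_eq_right (by linarith), h0, oddPow_of_nonneg hp hx, sub_zero]
  · rw [max_eq_right hx, max_eq_left (by linarith), h0,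
      ← oddPow_of_nonneg hp (neg_nonneg.2 hx), oddPow_neg]
    ring

theorem continuous_oddPow {p : ℝ} (hp : 1 < p) : Continuous (oddPow p) := by
  have h : oddPow p = fun x => max x 0 ^ (p - 1) - max (-x) 0 ^ (p - 1) :=
    funext (oddPow_eq_max hp)
  rw [h]
  have h1 : Continuous fun x : ℝ => max x 0 ^ (p - 1) :=
    (continuous_id.max continuous_const).rpow_const fun _ => Or.inr (sub_nonneg.2 hp.le)
  exact h1.sub (h1.comp continuous_neg)

/-- Young's inequality in the form of convexity of `|x| ^ p / p`. -/
theorem oddPow_mul_le {p : ℝ} (hp : 1 < p) (x y : ℝ) :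
    oddPow p x * (y - x) ≤ (|y| ^ p - |x| ^ p) / p := by
  have hpq := Real.HolderConjugate.conjExponent hp
  have hp0 : 0 < p := by linarith
  have h1 := Real.young_inequality (oddPow p x) y hpq.symm
  rw [abs_oddPow hp, ← Real.rpow_mul (abs_nonneg x), hpq.sub_one_mul_conj] at h1
  have h2 : |x| ^ p / p.conjExponent = |x| ^ p - |x| ^ p / p := by
    have := hpq.inv_add_inv_eq_one
    rw [div_eq_mul_inv, div_eq_mul_inv, eq_sub_iff_add_eq'.2 this]
    ring
  have h3 := oddPow_mul_self hp x
  rw [mul_sub, h3, sub_div]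
  linarith

theorem abs_rpow_strictConvex {p : ℝ} (hp : 1 < p) {x y : ℝ} (hxy : x ≠ y) :
    |(x + y) / 2| ^ p < (|x| ^ p + |y| ^ p) / 2 := by
  have hp0 : 0 < p := by linarith
  have hab : |(x + y) / 2| ≤ (|x| + |y|) / 2 := by
    rw [abs_div, abs_two]
    have := abs_add_le x y
    linarith
  by_cases h : |x| = |y|
  · rcases abs_eq_abs.1 h with h | h
    · exact absurd h hxy
    · subst h
      have hy : 0 < |y| := abs_pos.2 fun h0 => hxy (by simp [h0])
      have := Real.rpow_pos_of_pos hy p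
      simp only [neg_add_cancel, zero_div, abs_zero, Real.zero_rpow hp0.ne', abs_neg]
      linarith
  · have h1 := (strictConvexOn_rpow hp).2 (abs_nonneg x) (abs_nonneg y) h
      (show (0 : ℝ) < 1 / 2 by norm_num) (show (0 : ℝ) < 1 / 2 by norm_num) (by norm_num)
    simp only [smul_eq_mul] at h1
    calc |(x + y) / 2| ^ p ≤ ((|x| + |y|) / 2) ^ p :=
          Real.rpow_le_rpow (abs_nonneg _) hab hp0.le
      _ = (1 / 2 * |x| + 1 / 2 * |y|) ^ p := by ring_nf
      _ < _ := h1
      _ = _ := by ring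

theorem oddPow_sub_mul_sub_nonneg {p : ℝ} (hp : 1 < p) (x y : ℝ) :
    0 ≤ (oddPow p x - oddPow p y) * (x - y) := by
  have h1 := oddPow_mul_le hp x y
  have h2 := oddPow_mul_le hp y x
  have h3 : (|y| ^ p - |x| ^ p) / p + (|x| ^ p - |y| ^ p) / p = 0 := by ring
  nlinarith

/-- Adding the tangent inequalities at `x` and at `y`, both evaluated at the midpoint, would
contradict strict convexity if `x ≠ y`. -/
theorem eq_of_oddPow_sub_mul_sub_eq_zero {p : ℝ} (hp : 1 < p) {x y : ℝ}
    (h : (oddPow p x - oddPow p y) * (x - y) = 0) : x = y := by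
  by_contra hxy
  have h1 := oddPow_mul_le hp x ((x + y) / 2)
  have h2 := oddPow_mul_le hp y ((x + y) / 2)
  have h3 := abs_rpow_strictConvex hp hxy
  have hp0 : 0 < p := by linarith
  have h4 : (|(x + y) / 2| ^ p - |x| ^ p) / p + (|(x + y) / 2| ^ p - |y| ^ p) / p < 0 := by
    rw [← add_div]
    exact div_neg_of_neg_of_pos (by linarith) hp0
  have h5 : oddPow p x * ((x + y) / 2 - x) + oddPow p y * ((x + y) / 2 - y) =
      -((oddPow p x - oddPow p y) * (x - y)) / 2 := by ring
  rw [h] at h5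
  linarith

/-- Comparison of two homogeneous functions of the same degree on the plane. -/
theorem exists_le_add_mul_of_homogeneous {p : ℝ} (hp : 1 < p) {F G : ℝ × ℝ → ℝ}
    (hF : Continuous F) (hG : Continuous G)
    (hFh : ∀ c : ℝ, 0 < c → ∀ z, F (c • z) = c ^ p * F z)
    (hGh : ∀ c : ℝ, 0 < c → ∀ z, G (c • z) = c ^ p * G z)
    (hG0 : ∀ z, 0 ≤ G z) (hFG : ∀ z, G z = 0 → F z ≤ 0) {ε : ℝ} (hε : 0 < ε) :
    ∃ C : ℝ, 0 ≤ C ∧ ∀ x y : ℝ, F (x, y) ≤ ε * (|x| ^ p + |y| ^ p) + C * G (x, y) := by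
  have hp0 : 0 < p := by linarith
  -- On this compact part of the unit sphere `G` is positive, hence bounded below; on the rest of
  -- the sphere `F < ε`. Homogeneity extends the bound to the plane.
  let K : Set (ℝ × ℝ) := Metric.sphere 0 1 ∩ {z | ε ≤ F z}
  have hK : IsCompact K := (isCompact_sphere 0 1).inter_right (isClosed_le continuous_const hF)
  obtain ⟨C, hC0, hC⟩ : ∃ C : ℝ, 0 ≤ C ∧ ∀ z ∈ K, F z ≤ C * G z := by
    rcases K.eq_empty_or_nonempty with h | h
    · exact ⟨0, le_rfl, by simp [h]⟩
    have hpos : ∀ z ∈ K, 0 < G z := fun z hz => lt_of_le_of_ne (hG0 z) fun h0 =>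
      (hε.trans_le hz.2).not_ge (hFG z h0.symm)
    obtain ⟨z₀, hz₀, hm⟩ := hK.exists_isMinOn h hG.continuousOn
    obtain ⟨z₁, hz₁, hM⟩ := hK.exists_isMaxOn h hF.continuousOn
    have h1 : 0 < F z₁ := hε.trans_le hz₁.2
    refine ⟨F z₁ / G z₀, (div_pos h1 (hpos _ hz₀)).le, fun z hz => ?_⟩
    calc F z ≤ F z₁ := hM hz
      _ = F z₁ / G z₀ * G z₀ := (div_mul_cancel₀ _ (hpos _ hz₀).ne').symm
      _ ≤ F z₁ / G z₀ * G z :=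
        mul_le_mul_of_nonneg_left (hm hz) (div_pos h1 (hpos _ hz₀)).le
  refine ⟨C, hC0, fun x y => ?_⟩
  have hN : 0 ≤ |x| ^ p + |y| ^ p := by positivity
  rcases eq_or_ne (x, y) 0 with h0 | h0
  · have h2 := hFh 2 two_pos 0
    rw [smul_zero] at h2
    have h3 : (1 : ℝ) < 2 ^ p := Real.one_lt_rpow one_lt_two hp0
    have h4 : F 0 = 0 := by
      by_contra h5
      have : (2 : ℝ) ^ p = 1 := mul_right_cancel₀ h5 (by rw [one_mul]; exact h2.symm)
      linarith
    rw [h0, h4]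
    exact add_nonneg (mul_nonneg hε.le hN) (mul_nonneg hC0 (hG0 _))
  · set r := ‖(x, y)‖ with hr
    have hr0 : 0 < r := norm_pos_iff.2 h0
    set z : ℝ × ℝ := r⁻¹ • (x, y) with hz
    have hrz : (x, y) = r • z := by rw [hz, smul_smul, mul_inv_cancel₀ hr0.ne', one_smul]
    have hz1 : ‖z‖ = 1 := by
      rw [hz, norm_smul, norm_inv, Real.norm_of_nonneg hr0.le, ← hr, inv_mul_cancel₀ hr0.ne']
    have hrp : 0 < r ^ p := Real.rpow_pos_of_pos hr0 p
    have hle : r ^ p ≤ |x| ^ p + |y| ^ p := by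
      rw [hr, Prod.norm_def]
      change max ‖x‖ ‖y‖ ^ p ≤ _
      have h1 : 0 ≤ |x| ^ p := by positivity
      have h2 : 0 ≤ |y| ^ p := by positivity
      rcases max_choice ‖x‖ ‖y‖ with h | h <;> rw [h, Real.norm_eq_abs] <;> linarith
    have key : F z ≤ ε + C * G z := by
      by_cases h : ε ≤ F z
      · have := hC z ⟨by simpa using hz1, h⟩
        linarith
      · have := mul_nonneg hC0 (hG0 z)
        linarith
    calc F (x, y) = r ^ p * F z := by rw [hrz, hFh r hr0]
      _ ≤ r ^ p * (ε + C * G z) := mul_le_mul_of_nonneg_left key hrp.le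
      _ = ε * r ^ p + C * G (x, y) := by rw [hrz, hGh r hr0]; ring
      _ ≤ _ := by gcongr

/-- A form of uniform convexity that replaces Clarkson's inequalities; the `ε` term makes the
distinction between `p ≥ 2` and `p < 2` unnecessary. -/
theorem exists_abs_sub_rpow_le_convexGap {p : ℝ} (hp : 1 < p) {ε : ℝ} (hε : 0 < ε) :
    ∃ C : ℝ, 0 ≤ C ∧ ∀ x y : ℝ, |x - y| ^ p ≤
      ε * (|x| ^ p + |y| ^ p) + C * ((|x| ^ p + |y| ^ p) / 2 - |(x + y) / 2| ^ p) := by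
  have hp0 : 0 < p := by linarith
  have hc : Continuous fun x : ℝ => |x| ^ p :=
    continuous_abs.rpow_const fun _ => Or.inr hp0.le
  have hh : ∀ c : ℝ, 0 < c → ∀ x : ℝ, |c * x| ^ p = c ^ p * |x| ^ p := fun c hc x => by
    rw [abs_mul, abs_of_pos hc, Real.mul_rpow hc.le (abs_nonneg x)]
  refine exists_le_add_mul_of_homogeneous hp (F := fun z => |z.1 - z.2| ^ p)
    (G := fun z => (|z.1| ^ p + |z.2| ^ p) / 2 - |(z.1 + z.2) / 2| ^ p)
    (hc.comp (by fun_prop)) ?_ ?_ ?_ ?_ ?_ hε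
  · exact (((hc.comp continuous_fst).add (hc.comp continuous_snd)).div_const 2).sub
      (hc.comp (by fun_prop))
  · intro c h z
    simp only [Prod.smul_fst, Prod.smul_snd, smul_eq_mul, ← mul_sub, hh c h]
  · intro c h z
    simp only [Prod.smul_fst, Prod.smul_snd, smul_eq_mul, ← mul_add, mul_div_assoc, hh c h]
    ring
  · intro z
    by_cases h : z.1 = z.2
    · simp [h]
    · exact sub_nonneg.2 (abs_rpow_strictConvex hp h).le
  · intro z hz
    by_cases h : z.1 = z.2
    · simp [h, Real.zero_rpow hp0.ne']
    · exact absurd hz (sub_pos.2 (abs_rpow_strictConvex hp h)).ne'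

/-- Strict monotonicity made quantitative: after integration, a small monotone form forces a small
`L^p` distance. -/
theorem exists_abs_sub_rpow_le_oddPow {p : ℝ} (hp : 1 < p) {ε : ℝ} (hε : 0 < ε) :
    ∃ C : ℝ, 0 ≤ C ∧ ∀ x y : ℝ, |x - y| ^ p ≤
      ε * (|x| ^ p + |y| ^ p) + C * ((oddPow p x - oddPow p y) * (x - y)) := by
  have hp0 : 0 < p := by linarith
  have hJ := continuous_oddPow hp
  have hc : Continuous fun x : ℝ => |x| ^ p :=
    continuous_abs.rpow_const fun _ => Or.inr hp0.le
  refine exists_le_add_mul_of_homogeneous hp (F := fun z => |z.1 - z.2| ^ p)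
    (G := fun z => (oddPow p z.1 - oddPow p z.2) * (z.1 - z.2))
    (hc.comp (by fun_prop)) (by fun_prop) ?_ ?_ (fun z => oddPow_sub_mul_sub_nonneg hp _ _) ?_ hε
  · intro c h z
    simp only [Prod.smul_fst, Prod.smul_snd, smul_eq_mul, ← mul_sub]
    rw [abs_mul, abs_of_pos h, Real.mul_rpow h.le (abs_nonneg _)]
  · intro c h z
    simp only [Prod.smul_fst, Prod.smul_snd, smul_eq_mul, oddPow_mul hp h.le]
    have : c ^ p = c ^ (p - 1) * c := by rw [← Real.rpow_add_one h.ne', sub_add_cancel]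
    rw [this]
    ring
  · intro z hz
    simp [eq_of_oddPow_sub_mul_sub_eq_zero hp hz, Real.zero_rpow hp0.ne']

theorem exists_abs_oddPow_sub_rpow_le {p q : ℝ} (hpq : p.HolderConjugate q) {ε : ℝ} (hε : 0 < ε) :
    ∃ C : ℝ, 0 ≤ C ∧ ∀ x y : ℝ, |oddPow p x - oddPow p y| ^ q ≤
      ε * (|x| ^ p + |y| ^ p) + C * |x - y| ^ p := by
  have hp := hpq.lt
  have hp0 : 0 < p := by linarith
  have hJ := continuous_oddPow hp
  refine exists_le_add_mul_of_homogeneous hp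
    (F := fun z => |oddPow p z.1 - oddPow p z.2| ^ q)
    (G := fun z => |z.1 - z.2| ^ p) ?_ ?_ ?_ ?_ (fun z => by positivity) ?_ hε
  · exact Continuous.rpow_const (by fun_prop) fun _ => Or.inr hpq.symm.nonneg
  · exact Continuous.rpow_const (by fun_prop) fun _ => Or.inr hp0.le
  · intro c h z
    simp only [Prod.smul_fst, Prod.smul_snd, smul_eq_mul, oddPow_mul hp h.le, ← mul_sub]
    rw [abs_mul, abs_of_pos (Real.rpow_pos_of_pos h _),
      Real.mul_rpow (Real.rpow_nonneg h.le _) (abs_nonneg _), ← Real.rpow_mul h.le,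
      hpq.sub_one_mul_conj]
  · intro c h z
    simp only [Prod.smul_fst, Prod.smul_snd, smul_eq_mul, ← mul_sub]
    rw [abs_mul, abs_of_pos h, Real.mul_rpow h.le (abs_nonneg _)]
  · intro z hz
    have h1 : z.1 = z.2 := by
      rw [Real.rpow_eq_zero (abs_nonneg _) hp0.ne', abs_eq_zero, sub_eq_zero] at hz
      exact hz
    simp [h1, Real.zero_rpow hpq.symm.ne_zero]

/-- The way in which all inequalities with an `ε` and a constant depending on `ε` are used: `M`
bounds the norms, `d` is the quantity known to vanish. -/
theorem tendsto_zero_of_forall_le_mul_add {ι : Type*} {F : Filter ι} {e d : ι → ℝ} {M : ℝ}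
    (he : ∀ᶠ i in F, 0 ≤ e i) (hd : Tendsto d F (𝓝 0))
    (h : ∀ ε > 0, ∃ C : ℝ, ∀ᶠ i in F, e i ≤ ε * M + C * d i) : Tendsto e F (𝓝 0) := by
  rw [Metric.tendsto_nhds]
  intro η hη
  obtain ⟨C, hC⟩ := h (η / 2 / (|M| + 1)) (by positivity)
  have h1 : Tendsto (fun i => C * d i) F (𝓝 0) := by simpa using hd.const_mul C
  have h2 : η / 2 / (|M| + 1) * M ≤ η / 2 := by
    rw [div_mul_eq_mul_div, div_le_iff₀ (by positivity)]
    have := le_abs_self M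
    nlinarith
  filter_upwards [he, hC, h1.eventually (gt_mem_nhds (half_pos hη))] with i h3 h4 h5
  rw [Real.dist_eq, sub_zero, abs_of_nonneg h3]
  linarith

/-! ### Hölder's inequality and the odd power as a map from `L^p` to `L^q`. -/

section Lebesgue

variable {α : Type*} [MeasurableSpace α] {μ : Measure α} {p q : ℝ}

theorem integrable_abs_rpow (hp : 1 < p) {f : α → ℝ} (hf : MemLp f (ENNReal.ofReal p) μ) :
    Integrable (fun x => |f x| ^ p) μ := by
  have hp0 : 0 < p := by linarith
  have h := hf.integrable_norm_rpow (by simpa using hp0) ENNReal.ofReal_ne_top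
  rwa [ENNReal.toReal_ofReal hp0.le] at h

theorem memLp_of_integrable_abs_rpow (hp : 1 < p) {f : α → ℝ} (hf : AEStronglyMeasurable f μ)
    (h : Integrable (fun x => |f x| ^ p) μ) : MemLp f (ENNReal.ofReal p) μ := by
  have hp0 : 0 < p := by linarith
  rw [← integrable_norm_rpow_iff hf (by simpa using hp0) ENNReal.ofReal_ne_top,
    ENNReal.toReal_ofReal hp0.le]
  exact h

theorem norm_rpow_eq_integral [Fact (1 < p)] (X : Lp ℝ (ENNReal.ofReal p) μ) :
    ‖X‖ ^ p = ∫ x, |X x| ^ p ∂μ := by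
  have hp0 : 0 < p := zero_lt_one.trans (Fact.out : 1 < p)
  have h0 : 0 ≤ ∫ x, |X x| ^ p ∂μ := integral_nonneg fun x => by positivity
  rw [Lp.norm_def, (Lp.memLp X).eLpNorm_eq_integral_rpow_norm (by simpa using hp0)
    ENNReal.ofReal_ne_top, ENNReal.toReal_ofReal hp0.le]
  simp only [Real.norm_eq_abs]
  rw [ENNReal.toReal_ofReal (by positivity), ← Real.rpow_mul h0, inv_mul_cancel₀ hp0.ne',
    Real.rpow_one]

theorem integrable_mul_of_conj (hpq : p.HolderConjugate q) {f g : α → ℝ}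
    (hf : MemLp f (ENNReal.ofReal q) μ) (hg : MemLp g (ENNReal.ofReal p) μ) :
    Integrable (fun x => f x * g x) μ := by
  have := hpq.symm.ennrealOfReal
  exact hf.integrable_mul hg

/-- Hölder's inequality. -/
theorem integral_abs_mul_abs_le (hpq : p.HolderConjugate q) {f g : α → ℝ}
    (hf : MemLp f (ENNReal.ofReal q) μ) (hg : MemLp g (ENNReal.ofReal p) μ) :
    ∫ x, |f x * g x| ∂μ ≤ (∫ x, |f x| ^ q ∂μ) ^ (1 / q) * (∫ x, |g x| ^ p ∂μ) ^ (1 / p) := by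
  simp only [abs_mul]
  exact integral_mul_norm_le_Lp_mul_Lq hpq.symm hf hg

theorem abs_integral_mul_le (hpq : p.HolderConjugate q) {f g : α → ℝ}
    (hf : MemLp f (ENNReal.ofReal q) μ) (hg : MemLp g (ENNReal.ofReal p) μ) :
    |∫ x, f x * g x ∂μ| ≤ (∫ x, |f x| ^ q ∂μ) ^ (1 / q) * (∫ x, |g x| ^ p ∂μ) ^ (1 / p) :=
  abs_integral_le_integral_abs.trans (integral_abs_mul_abs_le hpq hf hg)

theorem memLp_oddPow (hpq : p.HolderConjugate q) {f : α → ℝ}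
    (hf : MemLp f (ENNReal.ofReal p) μ) :
    MemLp (fun x => oddPow p (f x)) (ENNReal.ofReal q) μ := by
  refine memLp_of_integrable_abs_rpow hpq.symm.lt
    ((continuous_oddPow hpq.lt).comp_aestronglyMeasurable hf.1) ?_
  simp only [abs_oddPow hpq.lt, ← Real.rpow_mul (abs_nonneg _), hpq.sub_one_mul_conj]
  exact integrable_abs_rpow hpq.lt hf

/-- Norm continuity of the superposition operator `X ↦ J(X)` from `L^p` to `L^q`, read off from the
pointwise inequality without extracting almost everywhere convergent subsequences. -/
theorem tendsto_integral_abs_oddPow_sub_rpow (hpq : p.HolderConjugate q) {ι : Type*}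
    {F : Filter ι} {X : ι → α → ℝ} {Y : α → ℝ} {M : ℝ}
    (hX : ∀ i, MemLp (X i) (ENNReal.ofReal p) μ) (hY : MemLp Y (ENNReal.ofReal p) μ)
    (hM : ∀ᶠ i in F, ∫ x, |X i x| ^ p ∂μ ≤ M)
    (h : Tendsto (fun i => ∫ x, |X i x - Y x| ^ p ∂μ) F (𝓝 0)) :
    Tendsto (fun i => ∫ x, |oddPow p (X i x) - oddPow p (Y x)| ^ q ∂μ) F (𝓝 0) := by
  refine tendsto_zero_of_forall_le_mul_add (M := M + ∫ x, |Y x| ^ p ∂μ)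
    (Eventually.of_forall fun i => integral_nonneg fun x => by positivity) h fun ε hε => ?_
  obtain ⟨C, hC0, hC⟩ := exists_abs_oddPow_sub_rpow_le hpq hε
  refine ⟨C, hM.mono fun i hi => ?_⟩
  have h1 := integrable_abs_rpow hpq.lt (hX i)
  have h2 := integrable_abs_rpow hpq.lt hY
  have h3 : Integrable (fun x => |X i x - Y x| ^ p) μ :=
    integrable_abs_rpow hpq.lt ((hX i).sub hY)
  calc ∫ x, |oddPow p (X i x) - oddPow p (Y x)| ^ q ∂μ
      ≤ ∫ x, (ε * (|X i x| ^ p + |Y x| ^ p) + C * |X i x - Y x| ^ p) ∂μ := by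
        refine integral_mono (integrable_abs_rpow hpq.symm.lt
          ((memLp_oddPow hpq (hX i)).sub (memLp_oddPow hpq hY))) ?_ fun x => hC _ _
        exact ((h1.add h2).const_mul ε).add (h3.const_mul C)
    _ = ε * (∫ x, |X i x| ^ p ∂μ + ∫ x, |Y x| ^ p ∂μ) + C * ∫ x, |X i x - Y x| ^ p ∂μ := by
        have h4 : Integrable (fun x => ε * (|X i x| ^ p + |Y x| ^ p)) μ :=
          (h1.add h2).const_mul ε
        rw [integral_add h4 (h3.const_mul C), integral_const_mul, integral_const_mul,
          integral_add h1 h2]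
    _ ≤ _ := by gcongr

theorem tendsto_integral_mul_of_tendsto_rpow (hpq : p.HolderConjugate q) {ι : Type*}
    {F : Filter ι} {f : ι → α → ℝ} {g : α → ℝ}
    (hf : ∀ i, MemLp (f i) (ENNReal.ofReal q) μ) (hg : MemLp g (ENNReal.ofReal p) μ)
    (h : Tendsto (fun i => ∫ x, |f i x| ^ q ∂μ) F (𝓝 0)) :
    Tendsto (fun i => ∫ x, f i x * g x ∂μ) F (𝓝 0) := by
  refine squeeze_zero_norm (fun i => abs_integral_mul_le hpq (hf i) hg) ?_
  have h1 : Tendsto (fun i => (∫ x, |f i x| ^ q ∂μ) ^ (1 / q)) F (𝓝 (0 ^ (1 / q))) :=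
    h.rpow_const (Or.inr (by have := hpq.symm.pos; positivity))
  rw [Real.zero_rpow (one_div_ne_zero hpq.symm.ne_zero)] at h1
  simpa using h1.mul_const ((∫ x, |g x| ^ p ∂μ) ^ (1 / p))

end Lebesgue

/-! ### The direct method in spaces embedded in `L^p`. -/

section Existence

variable {α : Type*} [MeasurableSpace α] {μ : Measure α} {p q : ℝ} [Fact (1 < p)]

theorem exists_norm_sub_rpow_le_convexGap {ε : ℝ} (hε : 0 < ε) :
    ∃ C : ℝ, 0 ≤ C ∧ ∀ X Y : Lp ℝ (ENNReal.ofReal p) μ, ‖X - Y‖ ^ p ≤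
      ε * (‖X‖ ^ p + ‖Y‖ ^ p) +
        C * ((‖X‖ ^ p + ‖Y‖ ^ p) / 2 - ‖(2⁻¹ : ℝ) • (X + Y)‖ ^ p) := by
  have hp : 1 < p := Fact.out
  obtain ⟨C, hC0, hC⟩ := exists_abs_sub_rpow_le_convexGap hp hε
  refine ⟨C, hC0, fun X Y => ?_⟩
  have hX := integrable_abs_rpow hp (Lp.memLp X)
  have hY := integrable_abs_rpow hp (Lp.memLp Y)
  have hS := integrable_abs_rpow hp (Lp.memLp ((2⁻¹ : ℝ) • (X + Y)))
  have hD := integrable_abs_rpow hp (Lp.memLp (X - Y))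
  simp only [norm_rpow_eq_integral]
  have hXY : Integrable (fun x => |X x| ^ p + |Y x| ^ p) μ := hX.add hY
  have hXY2 : Integrable (fun x => (|X x| ^ p + |Y x| ^ p) / 2) μ := hXY.div_const 2
  have hG : Integrable (fun x => (|X x| ^ p + |Y x| ^ p) / 2 -
      |((2⁻¹ : ℝ) • (X + Y) : Lp ℝ (ENNReal.ofReal p) μ) x| ^ p) μ := hXY2.sub hS
  rw [← integral_add hX hY, ← integral_div, ← integral_sub hXY2 hS,
    ← integral_const_mul, ← integral_const_mul,
    ← integral_add (hXY.const_mul ε) (hG.const_mul C)]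
  refine integral_mono_ae hD ((hXY.const_mul ε).add (hG.const_mul C)) ?_
  filter_upwards [Lp.coeFn_sub X Y, Lp.coeFn_smul (2⁻¹ : ℝ) (X + Y), Lp.coeFn_add X Y]
    with x h1 h2 h3
  have h4 : ((2⁻¹ : ℝ) • (X + Y) : Lp ℝ (ENNReal.ofReal p) μ) x = (X x + Y x) / 2 := by
    rw [h2, Pi.smul_apply, h3, Pi.add_apply, smul_eq_mul]; ring
  simp only [h1, h4, Pi.sub_apply]
  exact hC _ _

/-- The first variation of the `p`-th power of the norm. -/
theorem norm_add_smul_rpow_sub_le (hpq : p.HolderConjugate q) (X Y : Lp ℝ (ENNReal.ofReal p) μ)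
    (t : ℝ) : (‖X + t • Y‖ ^ p - ‖X‖ ^ p) / p ≤
      t * ∫ x, oddPow p ((X + t • Y : Lp ℝ (ENNReal.ofReal p) μ) x) * Y x ∂μ := by
  have hp : 1 < p := Fact.out
  set Z := X + t • Y with hZ
  have h1 := integrable_abs_rpow hp (Lp.memLp X)
  have h2 := integrable_abs_rpow hp (Lp.memLp Z)
  rw [norm_rpow_eq_integral, norm_rpow_eq_integral, ← integral_sub h2 h1, ← integral_div,
    ← integral_const_mul]
  refine integral_mono_ae ((h2.sub h1).div_const p)
    ((integrable_mul_of_conj hpq (memLp_oddPow hpq (Lp.memLp Z)) (Lp.memLp Y)).const_mul t) ?_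
  filter_upwards [Lp.coeFn_add X (t • Y), Lp.coeFn_smul t Y] with x h3 h4
  have h5 : X x - Z x = -(t * Y x) := by
    rw [hZ, h3, Pi.add_apply, h4, Pi.smul_apply, smul_eq_mul]; ring
  have h6 := oddPow_mul_le hp (Z x) (X x)
  rw [h5] at h6
  have h7 : (|Z x| ^ p - |X x| ^ p) / p = -((|X x| ^ p - |Z x| ^ p) / p) := by ring
  simp only [h7]
  linarith

/-- Existence for the equation `∫ |Tu|^(p-2) Tu Tv = f v` in a complete space embedded in `L^p`. -/
theorem exists_integral_oddPow_mul_eq {V : Type*} [NormedAddCommGroup V] [NormedSpace ℝ V]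
    [CompleteSpace V] (hpq : p.HolderConjugate q) (T : V →L[ℝ] Lp ℝ (ENNReal.ofReal p) μ) {K : ℝ}
    (hK : 0 ≤ K) (hT : ∀ v, ‖v‖ ≤ K * ‖T v‖) (f : StrongDual ℝ V) :
    ∃ u : V, ∀ v : V, ∫ x, oddPow p (T u x) * T v x ∂μ = f v := by
  have hp : 1 < p := Fact.out
  have hp0 : 0 < p := by linarith
  have hq0 : 0 < q := hpq.symm.pos
  set E : V → ℝ := fun v => ‖T v‖ ^ p / p - f v with hE
  have hEc : Continuous E :=
    (((T.continuous.norm).rpow_const fun _ => Or.inr hp0.le).div_const p).sub f.continuous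
  obtain ⟨C₀, hC₀⟩ : ∃ C₀ : ℝ, ∀ v, ‖T v‖ ^ p / (2 * p) ≤ E v + C₀ := by
    -- With `c ^ p = 2`, Young's inequality for `(‖T v‖ / c) * (c ‖f‖ K)` absorbs exactly half of
    -- `‖T v‖ ^ p / p`.
    set c : ℝ := (2 : ℝ) ^ (1 / p) with hc
    have hcpos : 0 < c := by positivity
    have hcp : c ^ p = 2 := by
      rw [hc, ← Real.rpow_mul two_pos.le, one_div_mul_cancel hp0.ne', Real.rpow_one]
    refine ⟨(c * (‖f‖ * K)) ^ q / q, fun v => ?_⟩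
    have h1 : f v ≤ (‖T v‖ / c) * (c * (‖f‖ * K)) := by
      calc f v ≤ ‖f v‖ := le_abs_self _
        _ ≤ ‖f‖ * ‖v‖ := f.le_opNorm v
        _ ≤ ‖f‖ * (K * ‖T v‖) := by gcongr; exact hT v
        _ = (‖T v‖ / c) * (c * (‖f‖ * K)) := by field_simp
    have h2 := Real.young_inequality_of_nonneg (a := ‖T v‖ / c) (b := c * (‖f‖ * K))
      (by positivity) (by positivity) hpq
    rw [Real.div_rpow (norm_nonneg _) hcpos.le, hcp] at h2
    have h3 : ‖T v‖ ^ p / p = ‖T v‖ ^ p / (2 * p) + ‖T v‖ ^ p / 2 / p := by field_simp; ring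
    simp only [hE]
    linarith
  have hbdd : BddBelow (Set.range E) := ⟨-C₀, by
    rintro _ ⟨v, rfl⟩
    have h1 := hC₀ v
    have h2 : 0 ≤ ‖T v‖ ^ p / (2 * p) := by positivity
    linarith⟩
  set m := sInf (Set.range E) with hm
  have hmle : ∀ v, m ≤ E v := fun v => csInf_le hbdd ⟨v, rfl⟩
  obtain ⟨u, hu⟩ : ∃ u : V, E u ≤ m := by
    have hex : ∀ k : ℕ, ∃ v, E v < m + 1 / (k + 1 : ℝ) := fun k => by
      have h1 : m < m + 1 / (k + 1 : ℝ) := lt_add_of_pos_right _ (by positivity)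
      obtain ⟨_, ⟨v, rfl⟩, hv⟩ := exists_lt_of_csInf_lt (Set.range_nonempty E) h1
      exact ⟨v, hv⟩
    choose v hv using hex
    have hlim : Tendsto (fun k : ℕ => 1 / (k + 1 : ℝ)) atTop (𝓝 0) :=
      tendsto_one_div_add_atTop_nhds_zero_nat
    have hbd : ∀ k, ‖T (v k)‖ ^ p ≤ 2 * p * (m + 1 + C₀) := fun k => by
      have h1 := hC₀ (v k)
      have h2 : 1 / (k + 1 : ℝ) ≤ 1 := by
        rw [div_le_one (by positivity)]; linarith [k.cast_nonneg (α := ℝ)]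
      rw [div_le_iff₀ (by positivity)] at h1
      nlinarith [hv k]
    have hlim2 : Tendsto (fun i : ℕ × ℕ => p * ((1 / (i.1 + 1 : ℝ) + 1 / (i.2 + 1 : ℝ)) / 2))
        atTop (𝓝 0) := by
      rw [← prod_atTop_atTop_eq]
      simpa using (((hlim.comp tendsto_fst).add (hlim.comp tendsto_snd)).div_const 2).const_mul p
    -- The linear part of `E` cancels in the convexity gap at the midpoint, and the energy there is
    -- at least `m`; so the gap of two almost minimizers is at most `p` times the mean of their
    -- errors, and uniform convexity makes the sequence Cauchy.
    have hdist : Tendsto (fun i : ℕ × ℕ => ‖T (v i.1) - T (v i.2)‖ ^ p) atTop (𝓝 0) := by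
      refine tendsto_zero_of_forall_le_mul_add
        (M := 2 * p * (m + 1 + C₀) + 2 * p * (m + 1 + C₀))
        (Eventually.of_forall fun i => by positivity) hlim2 fun ε hε => ?_
      obtain ⟨C, hC0, hC⟩ := exists_norm_sub_rpow_le_convexGap (μ := μ) (p := p) hε
      refine ⟨C, Eventually.of_forall fun i => (hC _ _).trans ?_⟩
      have h1 := hmle ((2⁻¹ : ℝ) • (v i.1 + v i.2))
      simp only [hE, map_smul, map_add, smul_eq_mul] at h1
      have h2 := hv i.1
      have h3 := hv i.2
      simp only [hE] at h2 h3
      have h4 : (‖T (v i.1)‖ ^ p + ‖T (v i.2)‖ ^ p) / 2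
          - ‖(2⁻¹ : ℝ) • (T (v i.1) + T (v i.2))‖ ^ p
          = p * ((‖T (v i.1)‖ ^ p / p + ‖T (v i.2)‖ ^ p / p) / 2
          - ‖(2⁻¹ : ℝ) • (T (v i.1) + T (v i.2))‖ ^ p / p) := by
        field_simp
      gcongr
      · exact hbd _
      · exact hbd _
      · rw [h4]
        gcongr
        linarith
    have hcau : CauchySeq v := by
      rw [cauchySeq_iff_tendsto_dist_atTop_0]
      have h1 : Tendsto (fun i : ℕ × ℕ => K * (‖T (v i.1) - T (v i.2)‖ ^ p) ^ (1 / p)) atTop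
          (𝓝 0) := by
        have := (hdist.rpow_const (p := 1 / p) (Or.inr (by positivity))).const_mul K
        rwa [Real.zero_rpow (one_div_ne_zero hp0.ne'), mul_zero] at this
      refine squeeze_zero (fun _ => dist_nonneg) (fun i => ?_) h1
      rw [← Real.rpow_mul (norm_nonneg _), mul_one_div_cancel hp0.ne', Real.rpow_one, ← map_sub,
        dist_eq_norm]
      exact hT _
    obtain ⟨u, hu⟩ := cauchySeq_tendsto_of_complete hcau
    refine ⟨u, ?_⟩
    have h1 : Tendsto (fun k => E (v k)) atTop (𝓝 (E u)) := (hEc.tendsto u).comp hu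
    have h2 : Tendsto (fun k : ℕ => m + 1 / (k + 1 : ℝ)) atTop (𝓝 (m + 0)) := hlim.const_add m
    rw [add_zero] at h2
    exact le_of_tendsto_of_tendsto' h1 h2 fun k => (hv k).le
  -- Minimality is compared only with `u + t v` for `t ↓ 0`; the opposite inequality follows by
  -- inserting `-v`. The norm is never differentiated: convexity bounds the difference quotient by
  -- an integral at `T u + t T v`, which is continuous in `t`.
  have hle : ∀ v : V, f v ≤ ∫ x, oddPow p (T u x) * T v x ∂μ := by
    intro v
    have hstep : ∀ t : ℝ, 0 < t → f v ≤
        ∫ x, oddPow p ((T u + t • T v : Lp ℝ (ENNReal.ofReal p) μ) x) * T v x ∂μ := by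
      intro t ht
      have h1 := hu.trans (hmle (u + t • v))
      have h2 := norm_add_smul_rpow_sub_le hpq (T u) (T v) t
      simp only [hE, map_add, map_smul, smul_eq_mul] at h1
      rw [sub_div] at h2
      have h3 : t * f v ≤ t * ∫ x, oddPow p ((T u + t • T v : Lp ℝ (ENNReal.ofReal p) μ) x) *
        T v x ∂μ := by linarith
      exact le_of_mul_le_mul_left h3 ht
    have hcv : Tendsto (fun t : ℝ => T u + t • T v) (𝓝[>] 0) (𝓝 (T u)) := by
      have : Continuous fun t : ℝ => T u + t • T v := by fun_prop
      have h := this.tendsto 0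
      rw [zero_smul, add_zero] at h
      exact h.mono_left nhdsWithin_le_nhds
    have hbd : ∀ᶠ t : ℝ in 𝓝[>] 0,
        ∫ x, |(T u + t • T v : Lp ℝ (ENNReal.ofReal p) μ) x| ^ p ∂μ ≤ ‖T u‖ ^ p + 1 := by
      have h := (hcv.norm.rpow_const (p := p) (Or.inr hp0.le)).eventually
        (ge_mem_nhds (lt_add_one (‖T u‖ ^ p)))
      filter_upwards [h] with t ht
      rwa [← norm_rpow_eq_integral]
    have hd : Tendsto (fun t : ℝ =>
        ∫ x, |(T u + t • T v : Lp ℝ (ENNReal.ofReal p) μ) x - T u x| ^ p ∂μ) (𝓝[>] 0) (𝓝 0) := by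
      have h1 : Tendsto (fun t : ℝ => ‖(T u + t • T v) - T u‖ ^ p) (𝓝[>] 0) (𝓝 0) := by
        have := ((hcv.sub_const (T u)).norm).rpow_const (p := p) (Or.inr hp0.le)
        simpa [Real.zero_rpow hp0.ne'] using this
      refine h1.congr fun t => ?_
      rw [norm_rpow_eq_integral]
      refine integral_congr_ae ?_
      filter_upwards [Lp.coeFn_sub (T u + t • T v) (T u)] with x hx
      rw [hx, Pi.sub_apply]
    have h1 := tendsto_integral_abs_oddPow_sub_rpow hpq
      (X := fun t : ℝ => ((T u + t • T v : Lp ℝ (ENNReal.ofReal p) μ) : α → ℝ))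
      (fun t => Lp.memLp _) (Lp.memLp (T u)) hbd hd
    have h2 := tendsto_integral_mul_of_tendsto_rpow hpq
      (fun t : ℝ => (memLp_oddPow hpq (Lp.memLp (T u + t • T v))).sub
        (memLp_oddPow hpq (Lp.memLp (T u)))) (Lp.memLp (T v)) h1
    refine sub_nonpos.1 (ge_of_tendsto h2 ?_)
    filter_upwards [self_mem_nhdsWithin] with t ht
    have h4 := hstep t ht
    simp only [Pi.sub_apply, sub_mul]
    rw [integral_sub (integrable_mul_of_conj hpq (memLp_oddPow hpq (Lp.memLp _)) (Lp.memLp _))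
      (integrable_mul_of_conj hpq (memLp_oddPow hpq (Lp.memLp _)) (Lp.memLp _))]
    linarith
  refine ⟨u, fun v => le_antisymm ?_ (hle v)⟩
  have h1 := hle (-v)
  have h2 : ∫ x, oddPow p (T u x) * T (-v) x ∂μ = -∫ x, oddPow p (T u x) * T v x ∂μ := by
    rw [← integral_neg, map_neg]
    refine integral_congr_ae ?_
    filter_upwards [Lp.coeFn_neg (T v)] with x hx
    rw [hx, Pi.neg_apply, mul_neg]
  rw [h2, map_neg] at h1
  linarith

/-- The same for a closed subspace, with a map defined on the whole space. -/
theorem Submodule.exists_integral_oddPow_mul_eq {E : Type*} [NormedAddCommGroup E]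
    [NormedSpace ℝ E] [CompleteSpace E] {S : Submodule ℝ E} (hS : IsClosed (S : Set E))
    (hpq : p.HolderConjugate q) (T : E →L[ℝ] Lp ℝ (ENNReal.ofReal p) μ) {K : ℝ}
    (hK : 0 ≤ K) (hT : ∀ v ∈ S, ‖v‖ ≤ K * ‖T v‖) (f : StrongDual ℝ S) :
    ∃ u : S, ∀ v : S, ∫ x, oddPow p (T u x) * T v x ∂μ = f v := by
  have : CompleteSpace S := hS.completeSpace_coe
  exact _root_.exists_integral_oddPow_mul_eq hpq (T ∘L S.subtypeL) hK (fun v => hT v v.2) f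

theorem Submodule.exists_abs_dual_le {E : Type*} [NormedAddCommGroup E] [NormedSpace ℝ E]
    (S : Submodule ℝ E) (f : StrongDual ℝ S) :
    ∃ C : ℝ, 0 ≤ C ∧ ∀ v : S, |f v| ≤ C * ‖(v : E)‖ :=
  ⟨‖f‖, f.opNorm_nonneg, f.le_opNorm⟩

/-- Multiplication by `a ^ (1 / p)` turns the equation with weight `a` into the unweighted one. -/
theorem exists_weight_map {l L : ℝ} (hl : 0 < l) {a : α → ℝ}
    (ha : AEStronglyMeasurable a μ) (hb : ∀ᵐ x ∂μ, l ≤ a x ∧ a x ≤ L) :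
    ∃ S : Lp ℝ (ENNReal.ofReal p) μ →L[ℝ] Lp ℝ (ENNReal.ofReal p) μ, ∃ K : ℝ, 0 ≤ K ∧
      (∀ X, ‖X‖ ≤ K * ‖S X‖) ∧
      ∀ X Y, ∫ x, oddPow p (S X x) * S Y x ∂μ = ∫ x, a x * oddPow p (X x) * Y x ∂μ := by
  have hp : 1 < p := Fact.out
  have hp0 : 0 < p := by linarith
  obtain ⟨m, hm⟩ : ∃ m : α → ℝ, m = fun x => |a x| ^ (1 / p) := ⟨_, rfl⟩
  have hmm : AEStronglyMeasurable m μ := by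
    have : Continuous fun x : ℝ => |x| ^ (1 / p) :=
      Continuous.rpow_const (by fun_prop) fun _ => Or.inr (by positivity)
    rw [hm]
    exact this.comp_aestronglyMeasurable ha
  have hmb : ∀ᵐ x ∂μ, 0 < m x ∧ l ^ (1 / p) ≤ m x ∧ m x ≤ L ^ (1 / p) ∧
      m x ^ (p - 1) * m x = a x := by
    filter_upwards [hb] with x hx
    have h1 : 0 < a x := hl.trans_le hx.1
    have h2 : m x = a x ^ (1 / p) := by simp only [hm, abs_of_pos h1]
    have h3 : 0 < m x := h2 ▸ Real.rpow_pos_of_pos h1 _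
    refine ⟨h3, ?_, ?_, ?_⟩
    · rw [h2]
      exact Real.rpow_le_rpow hl.le hx.1 (by positivity)
    · rw [h2]
      exact Real.rpow_le_rpow h1.le hx.2 (by positivity)
    · rw [← Real.rpow_add_one h3.ne', sub_add_cancel, h2, ← Real.rpow_mul h1.le,
        one_div_mul_cancel hp0.ne', Real.rpow_one]
  have hmL : MemLp m ⊤ μ := by
    refine memLp_top_of_bound hmm (L ^ (1 / p)) ?_
    filter_upwards [hmb] with x hx
    rw [Real.norm_of_nonneg hx.1.le]
    exact hx.2.2.1
  have hS : ∀ X : Lp ℝ (ENNReal.ofReal p) μ, (ContinuousLinearMap.mul ℝ ℝ).holderL μ ⊤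
      (ENNReal.ofReal p) (ENNReal.ofReal p) hmL.toLp X =ᵐ[μ] fun x => m x * X x := fun X => by
    filter_upwards [(ContinuousLinearMap.mul ℝ ℝ).coeFn_holder (r := ENNReal.ofReal p) hmL.toLp X,
      hmL.coeFn_toLp] with x h1 h2
    rw [← h2]
    exact h1
  refine ⟨(ContinuousLinearMap.mul ℝ ℝ).holderL μ ⊤ (ENNReal.ofReal p) (ENNReal.ofReal p)
    hmL.toLp, (l ^ (1 / p))⁻¹, by positivity, fun X => ?_, fun X Y => ?_⟩
  · refine Lp.norm_le_mul_norm_of_ae_le_mul ?_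
    filter_upwards [hS X, hmb] with x h1 h2
    rw [h1, norm_mul, ← mul_assoc]
    refine le_mul_of_one_le_left (norm_nonneg _) ?_
    rw [inv_mul_eq_div, one_le_div (by positivity), Real.norm_of_nonneg h2.1.le]
    exact h2.2.1
  · refine integral_congr_ae ?_
    filter_upwards [hS X, hS Y, hmb] with x h1 h2 h3
    rw [h1, h2, oddPow_mul hp h3.1.le, ← h3.2.2.2]
    ring

end Existence

/-! ### Weak-* compactness of the coefficients. -/

theorem exists_subseq_tendsto_inner {H : Type*} [NormedAddCommGroup H] [InnerProductSpace ℝ H]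
    [CompleteSpace H] [TopologicalSpace.SeparableSpace H] (x : ℕ → H) {R : ℝ}
    (hx : ∀ k, ‖x k‖ ≤ R) : ∃ φ : ℕ → ℕ, StrictMono φ ∧ ∃ y : H, ∀ z : H,
      Tendsto (fun k => inner ℝ (x (φ k)) z) atTop (𝓝 (inner ℝ y z)) := by
  obtain ⟨Λ, -, φ, hφ, hΛ⟩ := WeakDual.isSeqCompact_closedBall ℝ H 0 R
    (x := fun k => StrongDual.toWeakDual (InnerProductSpace.toDual ℝ H (x k)))
    (fun k => by simpa using hx k)
  refine ⟨φ, hφ, (InnerProductSpace.toDual ℝ H).symm (WeakDual.toStrongDual Λ), fun z => ?_⟩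
  rw [InnerProductSpace.toDual_symm_apply]
  exact ((WeakDual.eval_continuous z).tendsto Λ).comp hΛ

theorem tendsto_of_forall_approx {ι : Type*} {F : Filter ι} {f : ι → ℝ} {x : ℝ}
    (h : ∀ ε > 0, ∃ (g : ι → ℝ) (y : ℝ), Tendsto g F (𝓝 y) ∧ (∀ᶠ i in F, |f i - g i| ≤ ε) ∧
      |x - y| ≤ ε) : Tendsto f F (𝓝 x) := by
  rw [Metric.tendsto_nhds]
  intro η hη
  obtain ⟨g, y, hg, hfg, hxy⟩ := h (η / 4) (by positivity)
  filter_upwards [hfg, Metric.tendsto_nhds.1 hg (η / 4) (by positivity)] with i h1 h2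
  rw [Real.dist_eq] at h2 ⊢
  calc |f i - x| = |(f i - g i) + (g i - y) - (x - y)| := by ring_nf
    _ ≤ |f i - g i| + |g i - y| + |x - y| :=
      (abs_sub _ _).trans (by gcongr; exact abs_add_le _ _)
    _ < η := by linarith

section WeakStar

variable {α : Type*} [MeasurableSpace α] {μ : Measure α}

theorem integrable_mul_of_ae_bounds {a g : α → ℝ} {l L : ℝ} (ha : AEStronglyMeasurable a μ)
    (hb : ∀ᵐ x ∂μ, l ≤ a x ∧ a x ≤ L) (hg : Integrable g μ) :
    Integrable (fun x => a x * g x) μ := by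
  refine hg.bdd_mul (c := max |l| |L|) ha ?_
  filter_upwards [hb] with x hx
  exact abs_le_max_abs_abs hx.1 hx.2

/-- Sequential weak-* compactness of order intervals in `L^∞`. -/
theorem exists_subseq_weakStar [MeasurableSpace.CountablyGenerated α] [SigmaFinite μ] {l L : ℝ}
    (a : ℕ → α → ℝ) (ha : ∀ k, AEStronglyMeasurable (a k) μ)
    (hb : ∀ k, ∀ᵐ x ∂μ, l ≤ a k x ∧ a k x ≤ L) :
    ∃ φ : ℕ → ℕ, StrictMono φ ∧ ∃ a' : α → ℝ, AEStronglyMeasurable a' μ ∧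
      (∀ᵐ x ∂μ, l ≤ a' x ∧ a' x ≤ L) ∧ ∀ g : α → ℝ, Integrable g μ →
        Tendsto (fun k => ∫ x, a (φ k) x * g x ∂μ) atTop (𝓝 (∫ x, a' x * g x ∂μ)) := by
  have : Fact ((2 : ℝ≥0∞) ≠ ⊤) := ⟨by simp⟩
  set M := max |l| |L| with hM
  have hM0 : 0 ≤ M := (abs_nonneg l).trans (le_max_left _ _)
  -- A positive integrable weight `w` moves the problem to the Hilbert space `L²`: with `r = √w`,
  -- the functions `a k * r` are bounded there, and the limit is divided by `r` afterwards.
  obtain ⟨w', hw0', hwm', hwi'⟩ := exists_pos_lintegral_lt_of_sigmaFinite μ one_ne_zero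
  set w : α → ℝ := fun x => w' x with hw
  have hw0 : ∀ x, 0 < w x := fun x => by simpa [hw] using hw0' x
  have hwm : Measurable w := hwm'.coe_nnreal_real
  have hwi : Integrable w μ := by
    refine ⟨hwm.aestronglyMeasurable, ?_⟩
    rw [hasFiniteIntegral_iff_enorm]
    simpa [hw] using hwi'.trans ENNReal.one_lt_top
  set r : α → ℝ := fun x => √(w x) with hr
  have hr0 : ∀ x, 0 < r x := fun x => Real.sqrt_pos.2 (hw0 x)
  have hrr : ∀ x, r x * r x = w x := fun x => Real.mul_self_sqrt (hw0 x).le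
  have hrm : Measurable r := hwm.sqrt
  have hr2 : MemLp r 2 μ := by
    rw [memLp_two_iff_integrable_sq hrm.aestronglyMeasurable]
    simpa only [pow_two, hrr] using hwi
  have har : ∀ k, MemLp (fun x => a k x * r x) 2 μ := fun k => by
    refine (hr2.const_mul M).of_le ((ha k).mul hrm.aestronglyMeasurable) ?_
    filter_upwards [hb k] with x hx
    rw [norm_mul, norm_mul, Real.norm_of_nonneg hM0]
    gcongr
    exact abs_le_max_abs_abs hx.1 hx.2
  obtain ⟨φ, hφ, h, hh⟩ := exists_subseq_tendsto_inner (fun k => (har k).toLp)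
    (R := ‖(hr2.const_mul M).toLp‖) fun k => by
      refine Lp.norm_le_norm_of_ae_le ?_
      filter_upwards [hb k, (har k).coeFn_toLp, (hr2.const_mul M).coeFn_toLp] with x hx h1 h2
      rw [h1, h2, norm_mul, norm_mul, Real.norm_of_nonneg hM0]
      gcongr
      exact abs_le_max_abs_abs hx.1 hx.2
  have hconv : ∀ f : α → ℝ, MemLp f 2 μ →
      Tendsto (fun k => ∫ x, a (φ k) x * r x * f x ∂μ) atTop (𝓝 (∫ x, h x * f x ∂μ)) := by
    intro f hf
    have h1 := hh hf.toLp
    simp only [L2.inner_def] at h1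
    convert! h1 using 2
    · refine integral_congr_ae ?_
      filter_upwards [(har (φ ‹_›)).coeFn_toLp, hf.coeFn_toLp] with x h1 h2
      rw [h1, h2]
      simp [mul_comm]
    · refine integral_congr_ae ?_
      filter_upwards [hf.coeFn_toLp] with x h2
      rw [h2]
      simp [mul_comm]
  have hhm : AEStronglyMeasurable h μ := (Lp.memLp h).1
  set a' : α → ℝ := fun x => h x / r x with ha'
  have ha'm : AEStronglyMeasurable a' μ := (hhm.aemeasurable.div hrm.aemeasurable).aestronglyMeasurable
  have ha'r : ∀ x, a' x * r x = h x := fun x => div_mul_cancel₀ _ (hr0 x).ne'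
  have ha'w : ∀ x, a' x * w x = h x * r x := fun x => by rw [← hrr, ← mul_assoc, ha'r]
  have hint : Integrable (fun x => a' x * w x) μ := by
    simp only [ha'w]
    exact (Lp.memLp h).integrable_mul hr2
  have hset : ∀ s, MeasurableSet s →
      Tendsto (fun k => ∫ x in s, a (φ k) x * w x ∂μ) atTop (𝓝 (∫ x in s, a' x * w x ∂μ)) := by
    intro s hs
    have h1 := hconv (s.indicator r) (hr2.indicator hs)
    simp only [← integral_indicator hs]
    convert! h1 using 2
    · congr 1 with x
      by_cases hx : x ∈ s <;> simp [hx, mul_assoc, hrr]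
    · congr 1 with x
      by_cases hx : x ∈ s <;> simp [hx, ha'w]
  have hbd : ∀ᵐ x ∂μ, l ≤ a' x ∧ a' x ≤ L := by
    have h1 : (fun x => l * w x) ≤ᵐ[μ] fun x => a' x * w x := by
      refine ae_le_of_forall_setIntegral_le (hwi.const_mul l) hint fun s hs _ => ?_
      refine ge_of_tendsto' (hset s hs) fun k => setIntegral_mono_ae (hwi.const_mul l).integrableOn
        (integrable_mul_of_ae_bounds (ha _) (hb _) hwi).integrableOn ?_
      filter_upwards [hb (φ k)] with x hx
      exact mul_le_mul_of_nonneg_right hx.1 (hw0 x).le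
    have h2 : (fun x => a' x * w x) ≤ᵐ[μ] fun x => L * w x := by
      refine ae_le_of_forall_setIntegral_le hint (hwi.const_mul L) fun s hs _ => ?_
      refine le_of_tendsto' (hset s hs) fun k => setIntegral_mono_ae
        (integrable_mul_of_ae_bounds (ha _) (hb _) hwi).integrableOn
        (hwi.const_mul L).integrableOn ?_
      filter_upwards [hb (φ k)] with x hx
      exact mul_le_mul_of_nonneg_right hx.2 (hw0 x).le
    filter_upwards [h1, h2] with x h3 h4
    exact ⟨le_of_mul_le_mul_right h3 (hw0 x), le_of_mul_le_mul_right h4 (hw0 x)⟩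
  refine ⟨φ, hφ, a', ha'm, hbd, fun g hg => ?_⟩
  -- Cutting `g` at height `m w` gives `T m / r ∈ L²`, an admissible test function for the weak `L²`
  -- limit, while `T m → g` in `L^1`; the uniform bound on the coefficients makes the error uniform
  -- in `k`.
  set T : ℕ → α → ℝ := fun m x => max (-(m * w x)) (min (m * w x) (g x)) with hT
  have hTm : ∀ m, AEStronglyMeasurable (T m) μ := fun m =>
    ((hwm.const_mul _).neg.aemeasurable.max
      ((hwm.const_mul _).aemeasurable.min hg.1.aemeasurable)).aestronglyMeasurable
  have hTw : ∀ m x, |T m x| ≤ m * w x := fun m x => by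
    have : 0 ≤ m * w x := mul_nonneg m.cast_nonneg (hw0 x).le
    exact abs_le.2 ⟨le_max_left _ _, max_le (by linarith) (min_le_left _ _)⟩
  have hTg : ∀ m x, |g x - T m x| ≤ |g x| := fun m x => by
    have h0 : 0 ≤ m * w x := mul_nonneg m.cast_nonneg (hw0 x).le
    simp only [hT]
    rcases le_total 0 (g x) with h1 | h1
    · rw [max_eq_right (by have := le_min h0 h1; linarith), abs_of_nonneg h1,
        abs_of_nonneg (sub_nonneg.2 (min_le_right _ _))]
      have := le_min h0 h1
      linarith
    · rw [min_eq_right (h1.trans h0), abs_of_nonpos h1,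
        abs_of_nonpos (sub_nonpos.2 (le_max_right _ _))]
      have := max_le (by linarith : -(m * w x) ≤ 0) h1
      linarith
  have hTlim : ∀ x, Tendsto (fun m => |g x - T m x|) atTop (𝓝 0) := fun x => by
    obtain ⟨m₀, hm₀⟩ := exists_nat_ge (|g x| / w x)
    refine tendsto_const_nhds.congr' ?_
    filter_upwards [eventually_ge_atTop m₀] with m hm
    have h1 : |g x| ≤ m * w x := by
      rw [← div_le_iff₀ (hw0 x)]
      exact hm₀.trans (by exact_mod_cast hm)
    have h2 := abs_le.1 h1
    simp only [hT]
    rw [min_eq_right h2.2, max_eq_right h2.1, sub_self, abs_zero]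
  have hTi : ∀ m, Integrable (T m) μ := fun m =>
    (hwi.const_mul (m : ℝ)).mono' (hTm m) (Eventually.of_forall (hTw m))
  have hL1 : Tendsto (fun m => ∫ x, |g x - T m x| ∂μ) atTop (𝓝 0) := by
    have := tendsto_integral_of_dominated_convergence (μ := μ) (F := fun m x => |g x - T m x|)
      (f := fun _ => (0 : ℝ)) (fun x => |g x|)
      (fun m => ((hg.sub (hTi m)).abs).1) hg.abs
      (fun m => Eventually.of_forall fun x => by simpa using hTg m x)
      (Eventually.of_forall hTlim)
    simpa using this
  refine tendsto_of_forall_approx fun ε hε => ?_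
  obtain ⟨m, hm⟩ := ((hL1.const_mul M).eventually (gt_mem_nhds (by simpa using hε))).exists
  have hT2 : MemLp (fun x => T m x / r x) 2 μ := by
    refine (hr2.const_mul (m : ℝ)).of_le
      ((hTm m).aemeasurable.div hrm.aemeasurable).aestronglyMeasurable
      (Eventually.of_forall fun x => ?_)
    rw [norm_div, Real.norm_of_nonneg (hr0 x).le, div_le_iff₀ (hr0 x),
      Real.norm_of_nonneg (mul_nonneg m.cast_nonneg (hr0 x).le), mul_assoc, hrr]
    exact hTw m x
  have happ : ∀ b : α → ℝ, AEStronglyMeasurable b μ → (∀ᵐ x ∂μ, l ≤ b x ∧ b x ≤ L) →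
      |∫ x, b x * g x ∂μ - ∫ x, b x * T m x ∂μ| ≤ ε := by
    intro b hbm hbb
    rw [← integral_sub (integrable_mul_of_ae_bounds hbm hbb hg)
      (integrable_mul_of_ae_bounds hbm hbb (hTi m))]
    refine le_trans ?_ hm.le
    rw [← integral_const_mul, ← Real.norm_eq_abs]
    refine norm_integral_le_of_norm_le (((hg.sub (hTi m)).abs).const_mul M) ?_
    filter_upwards [hbb] with x hx
    rw [← mul_sub, norm_mul]
    gcongr
    · exact abs_le_max_abs_abs hx.1 hx.2
    · exact le_rfl
  refine ⟨fun k => ∫ x, a (φ k) x * T m x ∂μ, ∫ x, a' x * T m x ∂μ, ?_,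
    Eventually.of_forall fun k => happ _ (ha _) (hb _), happ _ ha'm hbd⟩
  have h1 := hconv _ hT2
  have h2 : ∀ (b : ℝ) x, b * r x * (T m x / r x) = b * T m x := fun b x => by
    have := (hr0 x).ne'
    field_simp
  simpa only [h2, ← ha'r] using h1

end WeakStar

/-! ### Completeness of the fractional Sobolev space and Poincaré's inequality. -/

section Space

variable {n : ℕ} {s p : ℝ} [Fact (1 < p)]

theorem exists_subseq_tendsto_ae_of_tendsto_Lp {α : Type*} [MeasurableSpace α] {μ : Measure α}
    {X : ℕ → Lp ℝ (ENNReal.ofReal p) μ} {Y : Lp ℝ (ENNReal.ofReal p) μ}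
    (h : Tendsto X atTop (𝓝 Y)) :
    ∃ φ : ℕ → ℕ, StrictMono φ ∧ ∀ᵐ x ∂μ, Tendsto (fun k => X (φ k) x) atTop (𝓝 (Y x)) :=
  (tendstoInMeasure_of_tendsto_Lp h).exists_seq_tendsto_ae

/-- Along a subsequence both components converge almost everywhere, and the relation between a
function and its nonlocal gradient is pointwise. -/
theorem isClosed_Wsp : IsClosed (Wsp n s p : Set (LpPair n p)) := by
  refine IsSeqClosed.isClosed fun w w' hw hlim => ?_
  have h1 : Tendsto (fun k => (w k).fst) atTop (𝓝 w'.fst) :=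
    ((WithLp.prod_continuous_ofLp _ _ _).fst.tendsto w').comp hlim
  have h2 : Tendsto (fun k => (w k).snd) atTop (𝓝 w'.snd) :=
    ((WithLp.prod_continuous_ofLp _ _ _).snd.tendsto w').comp hlim
  obtain ⟨φ, hφ, hφ'⟩ := exists_subseq_tendsto_ae_of_tendsto_Lp h1
  obtain ⟨ψ, hψ, hψ'⟩ := exists_subseq_tendsto_ae_of_tendsto_Lp (h2.comp hφ.tendsto_atTop)
  change (w'.snd : Rn n × Rn n → ℝ) =ᵐ[volume] nlGrad n s p w'.fst
  have h3 : ∀ᵐ z : Rn n × Rn n, ∀ k, (w k).snd z = nlGrad n s p (w k).fst z :=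
    ae_all_iff.2 fun k => hw k
  have h4 : ∀ᵐ z : Rn n × Rn n, Tendsto (fun k => (w (φ k)).fst z.1) atTop (𝓝 (w'.fst z.1)) :=
    Measure.quasiMeasurePreserving_fst.ae hφ'
  have h5 : ∀ᵐ z : Rn n × Rn n, Tendsto (fun k => (w (φ k)).fst z.2) atTop (𝓝 (w'.fst z.2)) :=
    Measure.quasiMeasurePreserving_snd.ae hφ'
  filter_upwards [h3, h4, h5, hψ'] with z h3 h4 h5 h6
  refine tendsto_nhds_unique h6 ?_
  simp only [Function.comp_apply, h3]
  exact ((h4.sub h5).div_const _).comp hψ.tendsto_atTop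

instance : CompleteSpace (Wsp n s p) := isClosed_Wsp.completeSpace_coe

/-- The nonlocal gradient of an element of `W^{s,p}(ℝⁿ)`, as an element of `L^p(ℝⁿ × ℝⁿ)`. -/
noncomputable def gradLp : Wsp n s p →L[ℝ] Lp ℝ (ENNReal.ofReal p)
    (volume : Measure (Rn n × Rn n)) :=
  WithLp.sndL _ ℝ _ _ ∘L (Wsp n s p).subtypeL

theorem gradLp_ae (w : Wsp n s p) :
    (gradLp w : Rn n × Rn n → ℝ) =ᵐ[volume] nlGrad n s p (wspFn w) := w.2

/-- The inclusion of `W^{s,p}(ℝⁿ)` in `L^p(ℝⁿ)`. -/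
noncomputable def toLpW : Wsp n s p →L[ℝ] Lp ℝ (ENNReal.ofReal p) (volume : Measure (Rn n)) :=
  WithLp.fstL _ ℝ _ _ ∘L (Wsp n s p).subtypeL

theorem norm_le_toLpW_add_gradLp (w : Wsp n s p) : ‖w‖ ≤ ‖toLpW w‖ + ‖gradLp w‖ := by
  have h : (w : LpPair n p) = WithLp.toLp _ (toLpW w, 0) + WithLp.toLp _ (0, gradLp w) := by
    rw [← WithLp.toLp_add, Prod.mk_add_mk, add_zero, zero_add]
    rfl
  calc ‖w‖ = ‖(w : LpPair n p)‖ := rfl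
    _ ≤ _ := by
      rw [h]
      refine (norm_add_le _ _).trans_eq ?_
      rw [WithLp.norm_toLp_fst, WithLp.norm_toLp_snd]

theorem norm_gradLp_le (w : Wsp n s p) : ‖gradLp w‖ ≤ ‖w‖ :=
  WithLp.norm_snd_le _ (w : LpPair n p)

theorem norm_toLpW_le (w : Wsp n s p) : ‖toLpW w‖ ≤ ‖w‖ :=
  WithLp.norm_fst_le _ (w : LpPair n p)

theorem memLp_wspFn (w : Wsp n s p) : MemLp (wspFn w) (ENNReal.ofReal p) volume :=
  Lp.memLp (toLpW w)

theorem memLp_nlGrad (w : Wsp n s p) :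
    MemLp (nlGrad n s p (wspFn w)) (ENNReal.ofReal p) volume :=
  (memLp_congr_ae (gradLp_ae w)).1 (Lp.memLp (gradLp w))

theorem norm_toLpW_rpow (w : Wsp n s p) : ‖toLpW w‖ ^ p = ∫ x, |wspFn w x| ^ p :=
  norm_rpow_eq_integral _

theorem norm_gradLp_rpow (w : Wsp n s p) :
    ‖gradLp w‖ ^ p = ∫ z, |nlGrad n s p (wspFn w) z| ^ p := by
  rw [norm_rpow_eq_integral]
  refine integral_congr_ae ?_
  filter_upwards [gradLp_ae w] with z hz
  rw [hz]

/-- Poincaré's inequality for functions vanishing outside a bounded set. -/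
theorem exists_poincare (hn : 1 ≤ n) (hs0 : 0 < s) {Ω : Set (Rn n)} (hΩ : Bornology.IsBounded Ω) :
    ∃ K : ℝ, 0 ≤ K ∧ ∀ w : Wsp n s p, (∀ᵐ x, x ∉ Ω → wspFn w x = 0) →
      ‖toLpW w‖ ≤ K * ‖gradLp w‖ := by
  have hp : 1 < p := Fact.out
  have hp0 : 0 < p := by linarith
  have : Nonempty (Fin n) := ⟨⟨0, hn⟩⟩
  obtain ⟨R, hR0, hR⟩ := hΩ.subset_ball_lt 0 0
  -- The unit ball about `c` avoids the ball of radius `R` containing `Ω`, so `w` vanishes on it and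
  -- `w(x) = w(x) - w(y)` for `y` there, with `|x - y| ≤ 2R + 2` for `x ∈ Ω`. Integrating over `y`
  -- in this ball gives the inequality.
  obtain ⟨c, hc⟩ := exists_norm_eq (Rn n) (show 0 ≤ R + 1 by linarith)
  set γ : ℝ := (n : ℝ) / p + s with hγ
  have hγ0 : 0 < γ := by positivity
  set A : Set (Rn n) := Metric.ball c 1 with hA
  set D : ℝ := (2 * R + 2) ^ γ with hD
  have hD0 : 0 < D := Real.rpow_pos_of_pos (by linarith) _
  set β : ℝ := volume.real A with hβ
  have hβ0 : 0 < β := ENNReal.toReal_pos (Metric.measure_ball_pos volume c one_pos).ne'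
    measure_ball_lt_top.ne
  refine ⟨D * (β ^ (1 / p))⁻¹, by positivity, fun w hw => ?_⟩
  have hpt : ∀ᵐ z : Rn n × Rn n, |wspFn w z.1| ^ p * A.indicator 1 z.2 ≤
      D ^ p * |nlGrad n s p (wspFn w) z| ^ p := by
    have h1 : ∀ᵐ z : Rn n × Rn n, z.1 ∉ Ω → wspFn w z.1 = 0 :=
      Measure.quasiMeasurePreserving_fst.ae hw
    have h2 : ∀ᵐ z : Rn n × Rn n, z.2 ∉ Ω → wspFn w z.2 = 0 :=
      Measure.quasiMeasurePreserving_snd.ae hw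
    filter_upwards [h1, h2] with z h1 h2
    have h0 : 0 ≤ D ^ p * |nlGrad n s p (wspFn w) z| ^ p := by positivity
    by_cases hz2 : z.2 ∈ A
    · by_cases hz1 : z.1 ∈ Ω
      · have h3 : ‖z.1‖ < R := by simpa using hR hz1
        have h4 : ‖z.2 - c‖ < 1 := by simpa [hA, dist_eq_norm] using hz2
        have h5 : R < ‖z.2‖ := by
          have := norm_sub_norm_le c z.2
          rw [norm_sub_rev] at this
          linarith
        have h6 : ‖z.2‖ < R + 2 := by
          have := norm_sub_norm_le z.2 c
          linarith
        have h7 : wspFn w z.2 = 0 := h2 fun h => by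
          have : ‖z.2‖ < R := by simpa using hR h
          linarith
        have h8 : 0 < ‖z.1 - z.2‖ := by
          have := norm_sub_norm_le z.2 z.1
          rw [norm_sub_rev] at this
          linarith
        have h9 : ‖z.1 - z.2‖ ≤ 2 * R + 2 := by
          have := norm_sub_le z.1 z.2
          linarith
        have h10 : 0 < ‖z.1 - z.2‖ ^ γ := Real.rpow_pos_of_pos h8 _
        rw [Set.indicator_of_mem hz2, Pi.one_apply, mul_one,
          ← Real.mul_rpow hD0.le (abs_nonneg _)]
        refine Real.rpow_le_rpow (abs_nonneg _) ?_ hp0.le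
        rw [nlGrad, h7, sub_zero, abs_div, abs_of_pos h10, mul_div_assoc', le_div_iff₀ h10,
          mul_comm]
        gcongr
        exact Real.rpow_le_rpow (norm_nonneg _) h9 hγ0.le
      · simpa [h1 hz1, Real.zero_rpow hp0.ne'] using h0
    · simpa [hz2] using h0
  have h1 : ‖toLpW w‖ ^ p * β ≤ (D * ‖gradLp w‖) ^ p := by
    rw [Real.mul_rpow hD0.le (norm_nonneg _), norm_toLpW_rpow, norm_gradLp_rpow,
      ← integral_const_mul]
    have h2 : β = ∫ y, A.indicator (1 : Rn n → ℝ) y := by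
      rw [integral_indicator_one measurableSet_ball]
    rw [h2, ← integral_prod_mul]
    refine integral_mono_of_nonneg (Eventually.of_forall fun z => ?_)
      ((integrable_abs_rpow hp (memLp_nlGrad w)).const_mul _) hpt
    exact mul_nonneg (by positivity) (Set.indicator_nonneg (fun _ _ => zero_le_one) _)
  have h3 : (‖toLpW w‖ * β ^ (1 / p)) ^ p ≤ (D * ‖gradLp w‖) ^ p := by
    rwa [Real.mul_rpow (norm_nonneg _) (by positivity), ← Real.rpow_mul hβ0.le,
      one_div_mul_cancel hp0.ne', Real.rpow_one]
  have h4 := (Real.rpow_le_rpow_iff (by positivity) (by positivity) hp0).1 h3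
  rw [mul_right_comm, ← div_eq_mul_inv, le_div_iff₀ (by positivity)]
  exact h4

/-- Poincaré's inequality is a closed condition, so it passes from test functions to their closure
with no regularity of `∂Ω`. -/
theorem exists_norm_le_mul_gradLp (hn : 1 ≤ n) (hs0 : 0 < s) {Ω : Set (Rn n)}
    (hΩ : Bornology.IsBounded Ω) :
    ∃ K : ℝ, 0 ≤ K ∧ ∀ w ∈ W0 n s p Ω, ‖w‖ ≤ K * ‖gradLp w‖ := by
  obtain ⟨K, hK0, hK⟩ := exists_poincare (p := p) hn hs0 hΩ
  refine ⟨K + 1, by linarith, fun w hw => ?_⟩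
  have hcl : IsClosed {v : Wsp n s p | ‖toLpW v‖ ≤ K * ‖gradLp v‖} :=
    isClosed_le toLpW.continuous.norm (gradLp.continuous.norm.const_mul K)
  have hsub : (testFunctions n s p Ω : Set (Wsp n s p)) ⊆ {v | ‖toLpW v‖ ≤ K * ‖gradLp v‖} := by
    rintro v ⟨φ, -, -, hφ, hv⟩
    refine hK v ?_
    filter_upwards [hv] with x hx hxΩ
    rw [hx]
    exact image_eq_zero_of_notMem_tsupport fun h => hxΩ (hφ h)
  have h1 : ‖toLpW w‖ ≤ K * ‖gradLp w‖ := closure_minimal hsub hcl hw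
  have h2 := norm_le_toLpW_add_gradLp w
  linarith

end Space

/-! ### Approximation by finitely many ball means, in place of a compact embedding. -/

section Averages

theorem memLp_indicator_one {α : Type*} [MeasurableSpace α] {μ : Measure α} {S : Set α}
    (hS : MeasurableSet S) (hμS : μ S ≠ ⊤) (r : ℝ≥0∞) :
    MemLp (S.indicator (1 : α → ℝ)) r μ :=
  memLp_indicator_const r hS 1 (Or.inr hμS)

theorem integral_abs_indicator_one_rpow {α : Type*} [MeasurableSpace α] {μ : Measure α}
    {S : Set α} (hS : MeasurableSet S) {q : ℝ} (hq : q ≠ 0) :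
    ∫ x, |S.indicator (1 : α → ℝ) x| ^ q ∂μ = μ.real S := by
  rw [← integral_indicator_one hS]
  congr 1 with x
  by_cases hx : x ∈ S <;> simp [hx, Real.zero_rpow hq]

theorem exists_simpleFunc_dist_lt {n : ℕ} {B : Set (Rn n)} (hB : TotallyBounded B) {δ : ℝ}
    (hδ : 0 < δ) : ∃ c : SimpleFunc (Rn n) (Rn n), ∀ x ∈ B, dist x (c x) < δ := by
  obtain ⟨t, ht, hBt⟩ := Metric.totallyBounded_iff.1 hB δ hδ
  have key : ∀ t : Set (Rn n), t.Finite →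
      ∃ c : SimpleFunc (Rn n) (Rn n), ∀ x ∈ ⋃ y ∈ t, Metric.ball y δ, dist x (c x) < δ := by
    intro t ht
    induction t, ht using Set.Finite.induction_on with
    | empty => exact ⟨SimpleFunc.const _ 0, by simp⟩
    | @insert y t _ _ ih =>
      obtain ⟨c, hc⟩ := ih
      refine ⟨SimpleFunc.piecewise (Metric.ball y δ) measurableSet_ball
        (SimpleFunc.const _ y) c, fun x hx => ?_⟩
      rw [SimpleFunc.piecewise_apply]
      split_ifs with h
      · exact h
      · rw [Set.biUnion_insert] at hx
        exact hc x (hx.resolve_left h)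
  obtain ⟨c, hc⟩ := key t ht
  exact ⟨c, fun x hx => hc x (hBt hx)⟩

/-- The powers of `δ` add up to `-n + (n/p + s) + n/q = s > 0`. This is the error constant of
`integral_abs_sub_ballMean_le`. -/
theorem tendsto_average_constant {n : ℕ} {s p q : ℝ} (hpq : p.HolderConjugate q) (hs0 : 0 < s)
    (V : ℝ) (hV : 0 ≤ V) :
    Tendsto (fun δ : ℝ => (volume.real (Metric.ball (0 : Rn n) δ))⁻¹ *
      (2 * δ) ^ ((n : ℝ) / p + s) * (V * volume.real (Metric.ball (0 : Rn n) δ)) ^ (1 / q))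
      (𝓝[>] 0) (𝓝 0) := by
  have hp0 := hpq.pos
  set N := volume.real (Metric.ball (0 : Rn n) 1) with hN
  have hN0 : 0 < N := ENNReal.toReal_pos (Metric.measure_ball_pos volume _ one_pos).ne'
    measure_ball_lt_top.ne
  have h1 : Tendsto (fun δ : ℝ => N⁻¹ * 2 ^ ((n : ℝ) / p + s) * (V * N) ^ (1 / q) * δ ^ s)
      (𝓝[>] 0) (𝓝 0) := by
    have h2 : Tendsto (fun δ : ℝ => δ ^ s) (𝓝[>] 0) (𝓝 (0 ^ s)) :=
      (tendsto_id.mono_left nhdsWithin_le_nhds).rpow_const (Or.inr hs0.le)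
    rw [Real.zero_rpow hs0.ne'] at h2
    simpa using h2.const_mul (N⁻¹ * 2 ^ ((n : ℝ) / p + s) * (V * N) ^ (1 / q))
  refine h1.congr' ?_
  filter_upwards [self_mem_nhdsWithin] with δ hδ
  have hδ : 0 < δ := hδ
  have h3 : volume.real (Metric.ball (0 : Rn n) δ) = δ ^ (n : ℝ) * N := by
    rw [measureReal_def, Measure.addHaar_ball_of_pos volume _ hδ, ENNReal.toReal_mul,
      ENNReal.toReal_ofReal (by positivity), Real.rpow_natCast]
    simp [hN, measureReal_def]
  have h4 : δ ^ s = (δ ^ (n : ℝ))⁻¹ * δ ^ ((n : ℝ) / p + s) * (δ ^ (n : ℝ)) ^ (1 / q) := by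
    rw [← Real.rpow_mul hδ.le, ← Real.rpow_neg hδ.le, ← Real.rpow_add hδ, ← Real.rpow_add hδ]
    congr 1
    have h5 : 1 / q = 1 - 1 / p := by
      have := hpq.inv_add_inv_eq_one
      rw [one_div, one_div]; linarith
    rw [h5]
    ring
  have h6 : (V * (δ ^ (n : ℝ) * N)) ^ (1 / q) =
      (δ ^ (n : ℝ)) ^ (1 / q) * (V * N) ^ (1 / q) := by
    rw [mul_left_comm, Real.mul_rpow (by positivity) (by positivity)]
  rw [h3, h4, h6, Real.mul_rpow two_pos.le hδ.le, mul_inv]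
  ring

variable {n : ℕ} {s p q : ℝ} [Fact (1 < p)]

theorem integrableOn_wspFn (w : Wsp n s p) {B : Set (Rn n)} (hB : volume B ≠ ⊤) :
    IntegrableOn (wspFn w) B := by
  have : IsFiniteMeasure (volume.restrict B) := ⟨by simpa using hB.lt_top⟩
  exact ((memLp_wspFn w).restrict B).integrable Fact.out

/-- The mean value of a function of `W^{s,p}(ℝⁿ)` on a ball. -/
noncomputable def ballMean (w : Wsp n s p) (δ : ℝ) (y : Rn n) : ℝ :=
  (volume.real (Metric.ball (0 : Rn n) δ))⁻¹ * ∫ x in Metric.ball y δ, wspFn w x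

theorem measureReal_ball_center (y : Rn n) (δ : ℝ) :
    volume.real (Metric.ball y δ) = volume.real (Metric.ball (0 : Rn n) δ) := by
  rw [measureReal_def, Measure.addHaar_ball_center, measureReal_def]

theorem abs_ballMean_le (hpq : p.HolderConjugate q) (w : Wsp n s p) {δ : ℝ} (y : Rn n) :
    |ballMean w δ y| ≤ (volume.real (Metric.ball (0 : Rn n) δ))⁻¹ *
      (volume.real (Metric.ball (0 : Rn n) δ) ^ (1 / q) * ‖toLpW w‖) := by
  have hp0 := hpq.pos
  rw [ballMean, abs_mul, abs_of_nonneg (inv_nonneg.2 measureReal_nonneg)]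
  gcongr
  have h := abs_integral_mul_le hpq (μ := volume) (f := (Metric.ball y δ).indicator 1)
    (memLp_indicator_one measurableSet_ball measure_ball_lt_top.ne _) (memLp_wspFn w)
  rw [integral_abs_indicator_one_rpow measurableSet_ball hpq.symm.ne_zero,
    measureReal_ball_center, ← norm_toLpW_rpow, ← Real.rpow_mul (norm_nonneg _),
    mul_one_div_cancel hp0.ne', Real.rpow_one] at h
  convert! h using 2
  rw [← integral_indicator measurableSet_ball]
  congr 1 with x
  by_cases hx : x ∈ Metric.ball y δ <;> simp [hx]

theorem abs_sub_le_mul_nlGrad (hs0 : 0 < s) (u : Rn n → ℝ) {x y : Rn n} {d : ℝ}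
    (h : ‖x - y‖ ≤ d) :
    |u x - u y| ≤ d ^ ((n : ℝ) / p + s) * |nlGrad n s p u (x, y)| := by
  have hp : 1 < p := Fact.out
  rcases eq_or_ne x y with rfl | hxy
  · simp only [sub_self, abs_zero]
    have := (norm_nonneg _).trans h
    positivity
  · have h1 : 0 < ‖x - y‖ := norm_pos_iff.2 (sub_ne_zero.2 hxy)
    have h2 : 0 < ‖x - y‖ ^ ((n : ℝ) / p + s) := Real.rpow_pos_of_pos h1 _
    rw [nlGrad, abs_div, abs_of_pos h2, mul_div_assoc', le_div_iff₀ h2, mul_comm]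
    gcongr

/-- A function of `W^{s,p}(ℝⁿ)` is close in `L^1(B)` to its means over small balls. -/
theorem integral_abs_sub_ballMean_le (hpq : p.HolderConjugate q) (hs0 : 0 < s) (w : Wsp n s p)
    {B : Set (Rn n)} (hB : MeasurableSet B) (hBf : volume B ≠ ⊤) {δ : ℝ} (hδ : 0 < δ)
    (c : SimpleFunc (Rn n) (Rn n)) (hc : ∀ x ∈ B, dist x (c x) < δ) :
    ∫ x in B, |wspFn w x - ballMean w δ (c x)| ≤
      (volume.real (Metric.ball (0 : Rn n) δ))⁻¹ * (2 * δ) ^ ((n : ℝ) / p + s) *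
        ((volume.real B * volume.real (Metric.ball (0 : Rn n) δ)) ^ (1 / q) * ‖gradLp w‖) := by
  have hp0 := hpq.pos
  set N := volume.real (Metric.ball (0 : Rn n) δ) with hN
  have hN0 : 0 < N := ENNReal.toReal_pos (Metric.measure_ball_pos volume _ hδ).ne'
    measure_ball_lt_top.ne
  -- For `x ∈ B` the deviation of `w(x)` from its mean over the ball about `c x` averages `w(x) -
  -- w(y)` over the section of `S` at `x`, where `|x - y| ≤ 2δ`. Hölder on `S`, of measure `|B|`
  -- times that of a `δ`-ball, finishes the estimate.
  set S : Set (Rn n × Rn n) := {z | z.1 ∈ B ∧ dist z.2 (c z.1) < δ} with hS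
  have hSm : MeasurableSet S := (measurable_fst hB).inter
    (measurableSet_lt (measurable_snd.dist (c.measurable.comp measurable_fst)) measurable_const)
  have hSv : volume S = volume B * volume (Metric.ball (0 : Rn n) δ) := by
    rw [Measure.volume_eq_prod, Measure.prod_apply hSm]
    have : ∀ x, volume (Prod.mk x ⁻¹' S) =
        B.indicator (fun _ => volume (Metric.ball (0 : Rn n) δ)) x := by
      intro x
      by_cases hx : x ∈ B
      · rw [Set.indicator_of_mem hx, ← Measure.addHaar_ball_center volume (c x)]
        congr 1 with y
        simp [hS, hx]
      · rw [Set.indicator_of_notMem hx]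
        convert! measure_empty (μ := (volume : Measure (Rn n)))
        ext y
        simp [hS, hx]
    simp only [this]
    rw [lintegral_indicator_const hB, mul_comm]
  have hSf : volume S ≠ ⊤ := by
    rw [hSv]
    exact ENNReal.mul_ne_top hBf measure_ball_lt_top.ne
  have hSr : volume.real S = volume.real B * N := by
    rw [measureReal_def, hSv, ENNReal.toReal_mul]; rfl
  set F : Rn n × Rn n → ℝ := fun z => S.indicator 1 z * nlGrad n s p (wspFn w) z with hF
  have hFi : Integrable F volume := integrable_mul_of_conj hpq (memLp_indicator_one hSm hSf _)
    (memLp_nlGrad w)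
  have hFle : ∫ z, |F z| ≤ (volume.real B * N) ^ (1 / q) * ‖gradLp w‖ := by
    have h := integral_abs_mul_abs_le hpq (μ := volume) (memLp_indicator_one hSm hSf _)
      (memLp_nlGrad w)
    rwa [integral_abs_indicator_one_rpow hSm hpq.symm.ne_zero, hSr, ← norm_gradLp_rpow,
      ← Real.rpow_mul (norm_nonneg _), mul_one_div_cancel hp0.ne', Real.rpow_one] at h
  have hae : ∀ᵐ x : Rn n, Integrable (fun y => |F (x, y)|) volume :=
    hFi.abs.prod_right_ae
  set κ : ℝ := (2 * δ) ^ ((n : ℝ) / p + s) with hκ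
  have hκ0 : 0 ≤ κ := by positivity
  have hpt : ∀ᵐ x : Rn n, x ∈ B →
      |wspFn w x - ballMean w δ (c x)| ≤ N⁻¹ * κ * ∫ y, |F (x, y)| := by
    filter_upwards [hae] with x hx hxB
    have h1 : wspFn w x - ballMean w δ (c x) =
        N⁻¹ * ∫ y in Metric.ball (c x) δ, (wspFn w x - wspFn w y) := by
      have h0 : IntegrableOn (fun _ => wspFn w x) (Metric.ball (c x) δ) :=
        integrableOn_const measure_ball_lt_top.ne
      rw [integral_sub h0 (integrableOn_wspFn w measure_ball_lt_top.ne), setIntegral_const,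
        measureReal_ball_center, ballMean, smul_eq_mul, mul_sub, inv_mul_cancel_left₀ hN0.ne']
    rw [h1, abs_mul, abs_of_pos (inv_pos.2 hN0), mul_assoc]
    gcongr
    rw [← integral_const_mul, ← Real.norm_eq_abs]
    refine (norm_integral_le_of_norm_le (hx.const_mul κ).integrableOn ?_).trans
      (setIntegral_le_integral (hx.const_mul κ) (Eventually.of_forall fun y => by positivity))
    filter_upwards [ae_restrict_mem measurableSet_ball] with y hy
    have h2 : (x, y) ∈ S := ⟨hxB, hy⟩
    have h3 : ‖x - y‖ ≤ 2 * δ := by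
      rw [← dist_eq_norm]
      have := dist_triangle_right x y (c x)
      have h4 := hc x hxB
      have h5 : dist y (c x) < δ := hy
      linarith
    simp only [hF, Set.indicator_of_mem h2, Pi.one_apply, one_mul]
    exact abs_sub_le_mul_nlGrad hs0 _ h3
  have hFint : Integrable (fun x => N⁻¹ * κ * ∫ y, |F (x, y)|) volume :=
    (hFi.abs.integral_prod_left).const_mul _
  calc ∫ x in B, |wspFn w x - ballMean w δ (c x)|
      ≤ ∫ x in B, N⁻¹ * κ * ∫ y, |F (x, y)| := by
        refine integral_mono_of_nonneg (Eventually.of_forall fun x => abs_nonneg _)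
          hFint.integrableOn ?_
        exact (ae_restrict_iff' hB).2 hpt
    _ ≤ ∫ x, N⁻¹ * κ * ∫ y, |F (x, y)| := by
        refine setIntegral_le_integral hFint (Eventually.of_forall fun x => ?_)
        exact mul_nonneg (by positivity) (integral_nonneg fun y => abs_nonneg _)
    _ = N⁻¹ * κ * ∫ z, |F z| := by
        rw [integral_const_mul, Measure.volume_eq_prod, integral_prod _ hFi.abs]
    _ ≤ _ := by gcongr

end Averages

/-! ### Compensated convergence of weak-* null coefficients against nonlocal gradients. -/

section CompensatedConvergence

variable {n : ℕ} {s p q : ℝ}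

/-- Since `H` is bounded and lives on `B × B`, only the `L^1(B)` norm of `f` matters, and
integrating out the second variable costs `|B|`. -/
theorem integral_mul_comp_fst_le {b H : Rn n × Rn n → ℝ} {M C : ℝ} {B : Set (Rn n)}
    (hbm : AEStronglyMeasurable b volume) (hbM : ∀ᵐ z, |b z| ≤ M) (hH : Measurable H)
    (hHC : ∀ z, |H z| ≤ C) (hB : MeasurableSet B) (hBf : volume B ≠ ⊤)
    (hHB : ∀ z, H z ≠ 0 → z.1 ∈ B ∧ z.2 ∈ B) (hM : 0 ≤ M) (hC : 0 ≤ C) {f : Rn n → ℝ}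
    (hf : IntegrableOn f B) :
    Integrable (fun z => b z * H z * f z.1) volume ∧
      |∫ z, b z * H z * f z.1| ≤ M * C * volume.real B * ∫ x in B, |f x| := by
  have h1 : Integrable (fun z : Rn n × Rn n =>
      M * C * (B.indicator (fun x => |f x|) z.1 * B.indicator (1 : Rn n → ℝ) z.2)) volume :=
    (Integrable.mul_prod ((integrable_indicator_iff hB).2 hf.abs)
      ((integrable_indicator_iff hB).2 (integrableOn_const hBf))).const_mul _
  have h2 : ∀ᵐ z : Rn n × Rn n, ‖b z * H z * f z.1‖ ≤
      M * C * (B.indicator (fun x => |f x|) z.1 * B.indicator (1 : Rn n → ℝ) z.2) := by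
    filter_upwards [hbM] with z hz
    by_cases h0 : H z = 0
    · rw [h0, mul_zero, zero_mul, norm_zero]
      exact mul_nonneg (mul_nonneg hM hC) (mul_nonneg
        (Set.indicator_nonneg (fun _ _ => abs_nonneg _) _)
        (Set.indicator_nonneg (fun _ _ => zero_le_one) _))
    · obtain ⟨h3, h4⟩ := hHB z h0
      rw [Set.indicator_of_mem h3, Set.indicator_of_mem h4, Pi.one_apply, mul_one, norm_mul,
        norm_mul]
      simp only [Real.norm_eq_abs]
      gcongr
      exact hHC z
  have h3 : AEStronglyMeasurable (fun z => b z * H z * f z.1) volume := by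
    have h4 : AEStronglyMeasurable (fun z : Rn n × Rn n => B.indicator f z.1) volume :=
      ((integrable_indicator_iff hB).2 hf).1.comp_quasiMeasurePreserving
        Measure.quasiMeasurePreserving_fst
    refine ((hbm.mul hH.aestronglyMeasurable).mul h4).congr (Eventually.of_forall fun z => ?_)
    by_cases h0 : H z = 0
    · simp [h0]
    · simp [(hHB z h0).1]
  refine ⟨h1.mono' h3 h2, ?_⟩
  have h5 := norm_integral_le_of_norm_le h1 h2
  rw [integral_const_mul, Measure.volume_eq_prod, integral_prod_mul, integral_indicator hB,
    integral_indicator_one hB] at h5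
  calc _ ≤ _ := h5
    _ = _ := by ring

variable [Fact (1 < p)]

/-- As `c` has finite range, the integral is a finite sum of ball means, bounded in `k`, times
integrals of `b k` against fixed integrable functions. -/
theorem tendsto_integral_mul_ballMean (hpq : p.HolderConjugate q)
    {b : ℕ → Rn n × Rn n → ℝ} {M : ℝ} (hM : 0 ≤ M)
    (hbm : ∀ k, AEStronglyMeasurable (b k) volume) (hbM : ∀ k, ∀ᵐ z, |b k z| ≤ M)
    (hb0 : ∀ g : Rn n × Rn n → ℝ, Integrable g volume →
      Tendsto (fun k => ∫ z, b k z * g z) atTop (𝓝 0))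
    {H : Rn n × Rn n → ℝ} {C : ℝ} (hH : Measurable H) (hC : 0 ≤ C) (hHC : ∀ z, |H z| ≤ C)
    {B : Set (Rn n)} (hB : MeasurableSet B) (hBf : volume B ≠ ⊤)
    (hHB : ∀ z, H z ≠ 0 → z.1 ∈ B ∧ z.2 ∈ B) (w : ℕ → Wsp n s p) {R : ℝ}
    (hw : ∀ k, ‖w k‖ ≤ R) (δ : ℝ) (c : SimpleFunc (Rn n) (Rn n)) :
    Tendsto (fun k => ∫ z, b k z * H z * ballMean (w k) δ (c z.1)) atTop (𝓝 0) := by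
  have hdom : ∀ (k : ℕ) (f : Rn n → ℝ), IntegrableOn f B →
      Integrable (fun z => b k z * H z * f z.1) volume ∧
      |∫ z, b k z * H z * f z.1| ≤ M * C * volume.real B * ∫ x in B, |f x| := fun k f hf =>
    integral_mul_comp_fst_le (hbm k) (hbM k) hH hHC hB hBf hHB hM hC hf
  set Hi : Rn n → Rn n × Rn n → ℝ := fun y z => H z * (c ⁻¹' {y}).indicator 1 z.1 with hHi
  have hIndi : ∀ y, IntegrableOn ((c ⁻¹' {y}).indicator (1 : Rn n → ℝ)) B := fun y =>
    (integrableOn_const (C := (1 : ℝ)) hBf).indicator (c.measurableSet_fiber y)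
  have hHii : ∀ y, Integrable (Hi y) volume := fun y => by
    have := (integral_mul_comp_fst_le (b := fun _ => 1) (M := 1) aestronglyMeasurable_const
      (Eventually.of_forall fun _ => by simp) hH hHC hB hBf hHB zero_le_one hC (hIndi y)).1
    simpa only [one_mul] using this
  have hsum : ∀ k, ∫ z, b k z * H z * ballMean (w k) δ (c z.1) =
      ∑ y ∈ c.range, ballMean (w k) δ y * ∫ z, b k z * Hi y z := by
    intro k
    have h1 : ∀ z : Rn n × Rn n, b k z * H z * ballMean (w k) δ (c z.1) =
        ∑ y ∈ c.range, ballMean (w k) δ y * (b k z * Hi y z) := by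
      intro z
      rw [Finset.sum_eq_single_of_mem (c z.1) (c.mem_range_self z.1)]
      · simp only [hHi, Set.indicator_of_mem (show z.1 ∈ c ⁻¹' {c z.1} from rfl), Pi.one_apply]
        ring
      · intro y _ hy
        have : z.1 ∉ c ⁻¹' {y} := fun h => hy h.symm
        simp [hHi, this]
    simp only [h1]
    rw [integral_finsetSum]
    · simp only [integral_const_mul]
    · intro y _
      refine Integrable.const_mul ?_ _
      have := (hdom k _ (hIndi y)).1
      simpa only [hHi, mul_assoc] using this
  simp only [hsum]
  rw [← Finset.sum_const_zero (s := c.range)]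
  refine tendsto_finsetSum _ fun y _ => ?_
  refine bdd_le_mul_tendsto_zero' ((volume.real (Metric.ball (0 : Rn n) δ))⁻¹ *
    (volume.real (Metric.ball (0 : Rn n) δ) ^ (1 / q) * R))
    (Eventually.of_forall fun k => ?_) (hb0 _ (hHii y))
  refine (abs_ballMean_le hpq (w k) y).trans ?_
  have : ‖toLpW (w k)‖ ≤ R := (norm_toLpW_le _).trans (hw k)
  gcongr

/-- Bounded sequences in `W^{s,p}(ℝⁿ)` may be multiplied by weak-* null sequences. -/
theorem tendsto_integral_mul_wspFn_fst (hpq : p.HolderConjugate q) (hs0 : 0 < s)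
    {b : ℕ → Rn n × Rn n → ℝ} {M : ℝ} (hM : 0 ≤ M)
    (hbm : ∀ k, AEStronglyMeasurable (b k) volume) (hbM : ∀ k, ∀ᵐ z, |b k z| ≤ M)
    (hb0 : ∀ g : Rn n × Rn n → ℝ, Integrable g volume →
      Tendsto (fun k => ∫ z, b k z * g z) atTop (𝓝 0))
    {H : Rn n × Rn n → ℝ} {C : ℝ} (hH : Measurable H) (hC : 0 ≤ C) (hHC : ∀ z, |H z| ≤ C)
    {B : Set (Rn n)} (hB : MeasurableSet B) (hBb : Bornology.IsBounded B)
    (hHB : ∀ z, H z ≠ 0 → z.1 ∈ B ∧ z.2 ∈ B) (w : ℕ → Wsp n s p) {R : ℝ}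
    (hw : ∀ k, ‖w k‖ ≤ R) :
    Tendsto (fun k => ∫ z, b k z * H z * wspFn (w k) z.1) atTop (𝓝 0) := by
  have hBf : volume B ≠ ⊤ := hBb.measure_lt_top.ne
  have hR : 0 ≤ R := (norm_nonneg _).trans (hw 0)
  refine tendsto_of_forall_approx fun ε hε => ?_
  have hlim := ((tendsto_average_constant (n := n) hpq hs0 (volume.real B)
    measureReal_nonneg).mul_const R).const_mul (M * C * volume.real B)
  rw [zero_mul, mul_zero] at hlim
  obtain ⟨δ, hδε, hδ⟩ := ((hlim.eventually (gt_mem_nhds hε)).and self_mem_nhdsWithin).exists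
  have hδ : 0 < δ := hδ
  obtain ⟨c, hc⟩ := exists_simpleFunc_dist_lt
    (hBb.isCompact_closure.totallyBounded.subset subset_closure) hδ
  have hPi : ∀ k, IntegrableOn (fun x => ballMean (w k) δ (c x)) B := fun k => by
    have : IsFiniteMeasure (volume.restrict B) := ⟨by simpa using hBf.lt_top⟩
    exact (c.map (ballMean (w k) δ)).integrable_of_isFiniteMeasure
  have hdom : ∀ (k : ℕ) (f : Rn n → ℝ), IntegrableOn f B →
      Integrable (fun z => b k z * H z * f z.1) volume ∧
      |∫ z, b k z * H z * f z.1| ≤ M * C * volume.real B * ∫ x in B, |f x| := fun k f hf =>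
    integral_mul_comp_fst_le (hbm k) (hbM k) hH hHC hB hBf hHB hM hC hf
  refine ⟨fun k => ∫ z, b k z * H z * ballMean (w k) δ (c z.1), 0, ?_, ?_, by simpa using hε.le⟩
  · exact tendsto_integral_mul_ballMean hpq hM hbm hbM hb0 hH hC hHC hB hBf hHB w hw δ c
  · refine Eventually.of_forall fun k => ?_
    have hvi := integrableOn_wspFn (w k) hBf
    rw [← integral_sub (hdom k _ hvi).1 (hdom k _ (hPi k)).1]
    have h1 := (hdom k _ (hvi.sub (hPi k))).2
    simp only [Pi.sub_apply, mul_sub] at h1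
    refine h1.trans (le_trans ?_ hδε.le)
    have h2 := integral_abs_sub_ballMean_le hpq hs0 (w k) hB hBf hδ c hc
    have h3 : ‖gradLp (w k)‖ ≤ R := (norm_gradLp_le _).trans (hw k)
    refine mul_le_mul_of_nonneg_left (h2.trans ?_) (by positivity)
    rw [mul_assoc _ _ R]
    gcongr

/-- Truncation of a function away from infinity, from the diagonal and from large values. -/
def truncSet (n : ℕ) (G : Rn n × Rn n → ℝ) (m : ℕ) : Set (Rn n × Rn n) :=
  {z | ‖z.1‖ < m ∧ ‖z.2‖ < m ∧ 1 < m * ‖z.1 - z.2‖ ∧ |G z| < m}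

theorem measurableSet_truncSet {G : Rn n × Rn n → ℝ} (hG : Measurable G) (m : ℕ) :
    MeasurableSet (truncSet n G m) := by
  have h1 : MeasurableSet {z : Rn n × Rn n | ‖z.1‖ < m} :=
    measurableSet_lt (by fun_prop) (by fun_prop)
  have h2 : MeasurableSet {z : Rn n × Rn n | ‖z.2‖ < m} :=
    measurableSet_lt (by fun_prop) (by fun_prop)
  have h3 : MeasurableSet {z : Rn n × Rn n | 1 < m * ‖z.1 - z.2‖} :=
    measurableSet_lt (by fun_prop) (by fun_prop)
  have h4 : MeasurableSet {z : Rn n × Rn n | |G z| < m} :=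
    measurableSet_lt hG.abs (by fun_prop)
  exact h1.inter (h2.inter (h3.inter h4))

theorem eventually_mem_truncSet (G : Rn n × Rn n → ℝ) {z : Rn n × Rn n} (hz : z.1 ≠ z.2) :
    ∀ᶠ m : ℕ in atTop, z ∈ truncSet n G m := by
  have h0 : 0 < ‖z.1 - z.2‖ := norm_pos_iff.2 (sub_ne_zero.2 hz)
  have h := tendsto_natCast_atTop_atTop (R := ℝ)
  filter_upwards [h.eventually_gt_atTop ‖z.1‖, h.eventually_gt_atTop ‖z.2‖,
    h.eventually_gt_atTop (1 / ‖z.1 - z.2‖), h.eventually_gt_atTop |G z|] with m h1 h2 h3 h4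
  exact ⟨h1, h2, (div_lt_iff₀ h0).1 h3, h4⟩

theorem tendsto_integral_mul_nlGrad_of_measurable (hpq : p.HolderConjugate q) (hs0 : 0 < s)
    {b : ℕ → Rn n × Rn n → ℝ} {M : ℝ} (hM : 0 ≤ M)
    (hbm : ∀ k, AEStronglyMeasurable (b k) volume) (hbM : ∀ k, ∀ᵐ z, |b k z| ≤ M)
    (hb0 : ∀ g : Rn n × Rn n → ℝ, Integrable g volume →
      Tendsto (fun k => ∫ z, b k z * g z) atTop (𝓝 0))
    {G : Rn n × Rn n → ℝ} (hGm : Measurable G) (hG : MemLp G (ENNReal.ofReal q) volume)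
    (hG0 : ∀ z, z.1 = z.2 → G z = 0) (w : ℕ → Wsp n s p) {R : ℝ} (hw : ∀ k, ‖w k‖ ≤ R) :
    Tendsto (fun k => ∫ z, b k z * G z * nlGrad n s p (wspFn (w k)) z) atTop (𝓝 0) := by
  have hp0 := hpq.pos
  have hq0 := hpq.symm.pos
  have hR : 0 ≤ R := (norm_nonneg _).trans (hw 0)
  set γ : ℝ := (n : ℝ) / p + s with hγ
  have hγ0 : 0 ≤ γ := by positivity
  set T : ℕ → Rn n × Rn n → ℝ := fun m => (truncSet n G m).indicator G with hT
  have hTm : ∀ m, Measurable (T m) := fun m => hGm.indicator (measurableSet_truncSet hGm m)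
  have hTL : ∀ m, MemLp (T m) (ENNReal.ofReal q) volume := fun m =>
    hG.indicator (measurableSet_truncSet hGm m)
  have hlim : Tendsto (fun m => ∫ z, |G z - T m z| ^ q) atTop (𝓝 0) := by
    have h := tendsto_integral_of_dominated_convergence (μ := (volume : Measure (Rn n × Rn n)))
      (F := fun m z => |G z - T m z| ^ q) (f := fun _ => (0 : ℝ)) (fun z => |G z| ^ q)
      (fun m => (integrable_abs_rpow hpq.symm.lt (hG.sub (hTL m))).1)
      (integrable_abs_rpow hpq.symm.lt hG)
      (fun m => Eventually.of_forall fun z => ?_) (Eventually.of_forall fun z => ?_)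
    · simpa using h
    · rw [Real.norm_of_nonneg (by positivity)]
      refine Real.rpow_le_rpow (abs_nonneg _) ?_ hq0.le
      by_cases hz : z ∈ truncSet n G m <;> simp [hT, hz]
    · refine tendsto_const_nhds.congr' ?_
      by_cases hz : z.1 = z.2
      · refine Eventually.of_forall fun m => ?_
        by_cases hz' : z ∈ truncSet n G m <;> simp [hT, hz', hG0 z hz, Real.zero_rpow hq0.ne']
      · filter_upwards [eventually_mem_truncSet G hz] with m hm
        simp [hT, hm, Real.zero_rpow hq0.ne']
  have hlim2 : Tendsto (fun m => M * (∫ z, |G z - T m z| ^ q) ^ (1 / q) * R) atTop (𝓝 0) := by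
    have := ((hlim.rpow_const (p := 1 / q) (Or.inr (by positivity))).const_mul M).mul_const R
    rwa [Real.zero_rpow (one_div_ne_zero hq0.ne'), mul_zero, zero_mul] at this
  have hint : ∀ k {f : Rn n × Rn n → ℝ}, MemLp f (ENNReal.ofReal q) volume →
      Integrable (fun z => b k z * f z * nlGrad n s p (wspFn (w k)) z) volume := by
    intro k f hf
    simp only [mul_assoc]
    exact (integrable_mul_of_conj hpq hf (memLp_nlGrad (w k))).bdd_mul (hbm k) (hbM k)
  refine tendsto_of_forall_approx fun ε hε => ?_
  obtain ⟨m, hm⟩ := (hlim2.eventually (gt_mem_nhds hε)).exists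
  refine ⟨fun k => ∫ z, b k z * T m z * nlGrad n s p (wspFn (w k)) z, 0, ?_,
    Eventually.of_forall fun k => ?_, by simpa using hε.le⟩
  -- On the truncation set `|G| < m` and `1 < m |x - y|`, so the singular denominator is harmless:
  -- `|H| ≤ m * m ^ γ`. The term with `w(y)` is reduced to the one with `w(x)` by swapping the
  -- variables in `b` and `H`.
  · set H : Rn n × Rn n → ℝ := fun z => T m z / ‖z.1 - z.2‖ ^ γ with hH
    have hHm : Measurable H := (hTm m).div (by fun_prop)
    have hHB : ∀ z, H z ≠ 0 → z.1 ∈ Metric.ball (0 : Rn n) m ∧ z.2 ∈ Metric.ball (0 : Rn n) m := by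
      intro z hz
      have hz' : z ∈ truncSet n G m := by
        by_contra h
        exact hz (by simp [hH, hT, h])
      simpa using ⟨hz'.1, hz'.2.1⟩
    have hHC : ∀ z, |H z| ≤ (m : ℝ) * (m : ℝ) ^ γ := by
      intro z
      by_cases hz : z ∈ truncSet n G m
      · have h1 := hz.2.2.1
        have hd : 0 < ‖z.1 - z.2‖ := by
          by_contra h
          have h2 : ‖z.1 - z.2‖ = 0 := le_antisymm (not_lt.1 h) (norm_nonneg _)
          rw [h2, mul_zero] at h1
          linarith
        simp only [hH, hT, Set.indicator_of_mem hz]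
        rw [abs_div, abs_of_pos (Real.rpow_pos_of_pos hd γ),
          div_le_iff₀ (Real.rpow_pos_of_pos hd γ), mul_assoc,
          ← Real.mul_rpow m.cast_nonneg (norm_nonneg _)]
        have h3 : 1 ≤ ((m : ℝ) * ‖z.1 - z.2‖) ^ γ := Real.one_le_rpow h1.le hγ0
        have h4 := hz.2.2.2
        nlinarith [abs_nonneg (G z)]
      · simp only [hH, hT, Set.indicator_of_notMem hz, zero_div, abs_zero]
        positivity
    have hvf : ∀ k, IntegrableOn (wspFn (w k)) (Metric.ball 0 m) := fun k =>
      integrableOn_wspFn (w k) measure_ball_lt_top.ne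
    have hC0 : (0 : ℝ) ≤ (m : ℝ) * (m : ℝ) ^ γ := by positivity
    have hswap : MeasurePreserving (Prod.swap : Rn n × Rn n → Rn n × Rn n) volume volume :=
      Measure.measurePreserving_swap
    have hbm' : ∀ k, AEStronglyMeasurable (fun z : Rn n × Rn n => b k z.swap) volume := fun k =>
      (hbm k).comp_measurePreserving hswap
    have hbM' : ∀ k, ∀ᵐ z : Rn n × Rn n, |b k z.swap| ≤ M := fun k =>
      hswap.quasiMeasurePreserving.ae (hbM k)
    have hHm' : Measurable fun z : Rn n × Rn n => H z.swap := hHm.comp measurable_swap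
    have hHB' : ∀ z : Rn n × Rn n, H z.swap ≠ 0 →
        z.1 ∈ Metric.ball (0 : Rn n) m ∧ z.2 ∈ Metric.ball (0 : Rn n) m := fun z hz =>
      (hHB _ hz).symm
    have h1 := tendsto_integral_mul_wspFn_fst hpq hs0 hM hbm hbM hb0 hHm hC0 hHC
      measurableSet_ball Metric.isBounded_ball hHB w hw
    have h2 := tendsto_integral_mul_wspFn_fst hpq hs0 hM hbm' hbM' (fun g hg => by
        have h3 := hb0 (fun z : Rn n × Rn n => g z.swap) (hswap.integrable_comp_of_integrable hg)
        refine h3.congr fun k => ?_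
        have h4 := integral_prod_swap (μ := (volume : Measure (Rn n)))
          (ν := (volume : Measure (Rn n))) (fun z : Rn n × Rn n => b k z.swap * g z)
        simp only [Prod.swap_swap] at h4
        exact h4) hHm' hC0 (fun z => hHC _)
      measurableSet_ball Metric.isBounded_ball hHB' w hw
    have h3 := h1.sub h2
    rw [sub_zero] at h3
    refine h3.congr fun k => ?_
    have h4 := (integral_mul_comp_fst_le (hbm' k) (hbM' k) hHm' (fun z => hHC _)
      measurableSet_ball measure_ball_lt_top.ne hHB' hM hC0 (hvf k)).1
    have h5 : Integrable (fun z : Rn n × Rn n => b k z * H z * wspFn (w k) z.2) volume := by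
      have := hswap.integrable_comp_of_integrable h4
      simpa only [Function.comp_def, Prod.swap_swap, Prod.fst_swap] using this
    have h6 : ∫ z : Rn n × Rn n, b k z.swap * H z.swap * wspFn (w k) z.1 =
        ∫ z : Rn n × Rn n, b k z * H z * wspFn (w k) z.2 :=
      integral_prod_swap (μ := (volume : Measure (Rn n)))
        (ν := (volume : Measure (Rn n))) (fun z => b k z * H z * wspFn (w k) z.2)
    rw [h6, ← integral_sub (integral_mul_comp_fst_le (hbm k) (hbM k) hHm hHC
      measurableSet_ball measure_ball_lt_top.ne hHB hM hC0 (hvf k)).1 h5]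
    congr 1 with z
    simp only [hH, nlGrad]
    ring
  · rw [← integral_sub (hint k hG) (hint k (hTL m))]
    refine le_trans ?_ hm.le
    have h1 := integral_abs_mul_abs_le hpq (hG.sub (hTL m)) (memLp_nlGrad (w k))
    rw [← norm_gradLp_rpow, ← Real.rpow_mul (norm_nonneg _), mul_one_div_cancel hp0.ne',
      Real.rpow_one] at h1
    have h2 : ‖gradLp (w k)‖ ≤ R := (norm_gradLp_le _).trans (hw k)
    have h3 := integrable_mul_of_conj hpq (hG.sub (hTL m)) (memLp_nlGrad (w k))
    calc |∫ z, (b k z * G z * nlGrad n s p (wspFn (w k)) z -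
          b k z * T m z * nlGrad n s p (wspFn (w k)) z)|
        ≤ ∫ z, M * |(G - T m) z * nlGrad n s p (wspFn (w k)) z| := by
          rw [← Real.norm_eq_abs]
          refine norm_integral_le_of_norm_le (h3.abs.const_mul M) ?_
          filter_upwards [hbM k] with z hz
          rw [← sub_mul, ← mul_sub, mul_assoc, norm_mul]
          exact mul_le_mul_of_nonneg_right hz (norm_nonneg _)
      _ = M * ∫ z, |(G - T m) z * nlGrad n s p (wspFn (w k)) z| := integral_const_mul _ _
      _ ≤ M * ((∫ z, |(G - T m) z| ^ q) ^ (1 / q) * R) := by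
          gcongr
          refine h1.trans ?_
          gcongr
      _ = _ := by simp only [Pi.sub_apply]; ring

/-- Compensated convergence: a weak-* null sequence times a fixed function of `L^{p'}`, tested
against nonlocal gradients of a bounded sequence. -/
theorem tendsto_integral_mul_nlGrad (hpq : p.HolderConjugate q) (hs0 : 0 < s)
    {b : ℕ → Rn n × Rn n → ℝ} {M : ℝ} (hM : 0 ≤ M)
    (hbm : ∀ k, AEStronglyMeasurable (b k) volume) (hbM : ∀ k, ∀ᵐ z, |b k z| ≤ M)
    (hb0 : ∀ g : Rn n × Rn n → ℝ, Integrable g volume →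
      Tendsto (fun k => ∫ z, b k z * g z) atTop (𝓝 0))
    {G : Rn n × Rn n → ℝ} (hG : MemLp G (ENNReal.ofReal q) volume)
    (w : ℕ → Wsp n s p) {R : ℝ} (hw : ∀ k, ‖w k‖ ≤ R) :
    Tendsto (fun k => ∫ z, b k z * G z * nlGrad n s p (wspFn (w k)) z) atTop (𝓝 0) := by
  -- The nonlocal gradient is zero on the diagonal, so `G` may be set to zero there without changing
  -- the integrals; truncations then converge at every point.
  set S : Set (Rn n × Rn n) := {z | z.1 ≠ z.2} with hS
  have hSm : MeasurableSet S := (measurableSet_eq_fun measurable_fst measurable_snd).compl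
  set G' := hG.1.mk G with hG'
  have hG'L : MemLp G' (ENNReal.ofReal q) volume := (memLp_congr_ae hG.1.ae_eq_mk).1 hG
  have h := tendsto_integral_mul_nlGrad_of_measurable hpq hs0 hM hbm hbM hb0
    (hG.1.stronglyMeasurable_mk.measurable.indicator hSm) (hG'L.indicator hSm)
    (fun z hz => by simp [hS, hz]) w hw
  refine h.congr fun k => integral_congr_ae ?_
  filter_upwards [hG.1.ae_eq_mk] with z hz
  by_cases hzS : z.1 = z.2
  · simp [nlGrad, hzS]
  · rw [Set.indicator_of_mem (show z ∈ S from hzS), hz]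

end CompensatedConvergence

/-! ### Weak solutions: existence, uniqueness, bounds and stability. -/

section Equation

variable {n : ℕ} {s p q : ℝ}

theorem aestronglyMeasurable_coeff {l L : ℝ} {a : Rn n × Rn n → ℝ}
    (ha : a ∈ CoeffClass n l L) : AEStronglyMeasurable a volume := ha.1.1

theorem ae_bounds_coeff {l L : ℝ} {a : Rn n × Rn n → ℝ}
    (ha : a ∈ CoeffClass n l L) : ∀ᵐ z, l ≤ a z ∧ a z ≤ L := ha.2.2

theorem flux_eq (a : Rn n × Rn n → ℝ) (u : Rn n → ℝ) (z : Rn n × Rn n) :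
    flux n s p a u z = a z * oddPow p (nlGrad n s p u z) := by
  rw [flux, oddPow, mul_assoc]

/-- The kernel exponent splits as `n + sp = p (n/p + s)`, with `p - 1` factors in the flux and one
in the test gradient; on the diagonal both sides vanish. -/
theorem weak_integrand_eq (hp : 1 < p) (a : Rn n × Rn n → ℝ) (u v : Rn n → ℝ)
    (z : Rn n × Rn n) :
    a z * |u z.1 - u z.2| ^ (p - 2) * (u z.1 - u z.2) * (v z.1 - v z.2) /
      ‖z.1 - z.2‖ ^ ((n : ℝ) + s * p) = flux n s p a u z * nlGrad n s p v z := by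
  by_cases hz : z.1 = z.2
  · simp [nlGrad, hz]
  have h0 : 0 < ‖z.1 - z.2‖ := norm_pos_iff.2 (sub_ne_zero.2 hz)
  obtain ⟨ρ, hρ⟩ : ∃ ρ, ρ = ‖z.1 - z.2‖ ^ ((n : ℝ) / p + s) := ⟨_, rfl⟩
  have hρ0 : 0 < ρ := hρ ▸ Real.rpow_pos_of_pos h0 _
  have h1 : ‖z.1 - z.2‖ ^ ((n : ℝ) + s * p) = ρ ^ (p - 2) * ρ * ρ := by
    rw [← Real.rpow_add_one hρ0.ne', ← Real.rpow_add_one hρ0.ne', hρ, ← Real.rpow_mul h0.le]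
    congr 1
    have : p ≠ 0 := by linarith
    field_simp
    ring
  have h2 : 0 < ρ ^ (p - 2) := Real.rpow_pos_of_pos hρ0 _
  simp only [flux, nlGrad]
  rw [h1, ← hρ, abs_div, abs_of_pos hρ0, Real.div_rpow (abs_nonneg _) hρ0.le]
  field_simp

theorem memLp_coeff_mul {l L : ℝ} (hl : 0 ≤ l) {a f : Rn n × Rn n → ℝ}
    (ha : a ∈ CoeffClass n l L) {r : ℝ≥0∞} (hf : MemLp f r volume) :
    MemLp (fun z => a z * f z) r volume := by
  refine (hf.const_mul L).of_le ((aestronglyMeasurable_coeff ha).mul hf.1) ?_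
  filter_upwards [(ae_bounds_coeff ha)] with z hz
  rw [norm_mul, norm_mul]
  gcongr
  rw [Real.norm_of_nonneg (hl.trans hz.1)]
  exact hz.2.trans (le_abs_self L)

variable [Fact (1 < p)]

theorem nlGrad_sub_ae (v w : Wsp n s p) : nlGrad n s p (wspFn (v - w)) =ᵐ[volume]
    fun z => nlGrad n s p (wspFn v) z - nlGrad n s p (wspFn w) z := by
  filter_upwards [gradLp_ae v, gradLp_ae w, gradLp_ae (v - w),
    Lp.coeFn_sub (gradLp v) (gradLp w)] with z h1 h2 h3 h4
  rw [← h3, map_sub, h4, Pi.sub_apply, h1, h2]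

theorem memLp_flux (hpq : p.HolderConjugate q) {l L : ℝ} (hl : 0 ≤ l) {a : Rn n × Rn n → ℝ}
    (ha : a ∈ CoeffClass n l L) (u : Wsp n s p) :
    MemLp (flux n s p a (wspFn u)) (ENNReal.ofReal q) volume := by
  have := memLp_coeff_mul hl ha (memLp_oddPow hpq (memLp_nlGrad u))
  simpa only [← flux_eq] using this

theorem continuous_integral_mul_nlGrad (hpq : p.HolderConjugate q) {g : Rn n × Rn n → ℝ}
    (hg : MemLp g (ENNReal.ofReal q) volume) :
    Continuous fun v : Wsp n s p => ∫ z, g z * nlGrad n s p (wspFn v) z := by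
  have hp0 := hpq.pos
  refine continuous_iff_continuousAt.2 fun v₀ => ?_
  have h1 : Tendsto (fun v : Wsp n s p => ∫ z, |nlGrad n s p (wspFn (v - v₀)) z| ^ p) (𝓝 v₀)
      (𝓝 0) := by
    have h2 : Continuous fun v : Wsp n s p => ‖gradLp (v - v₀)‖ ^ p :=
      Continuous.rpow_const (gradLp.continuous.comp (continuous_id.sub continuous_const)).norm
        fun _ => Or.inr hp0.le
    have h3 := h2.tendsto v₀
    simpa only [sub_self, map_zero, norm_zero, Real.zero_rpow hp0.ne', norm_gradLp_rpow] using h3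
  have h2 := tendsto_integral_mul_of_tendsto_rpow hpq.symm (fun v => memLp_nlGrad (v - v₀)) hg h1
  refine tendsto_sub_nhds_zero_iff.1 (h2.congr fun v => ?_)
  rw [← integral_sub (integrable_mul_of_conj hpq hg (memLp_nlGrad v))
    (integrable_mul_of_conj hpq hg (memLp_nlGrad v₀))]
  refine integral_congr_ae ?_
  filter_upwards [nlGrad_sub_ae v v₀] with z hz
  rw [hz]
  ring

theorem isClosed_W0 (Ω : Set (Rn n)) : IsClosed (W0 n s p Ω : Set (Wsp n s p)) :=
  Submodule.isClosed_topologicalClosure (testFunctions n s p Ω)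

theorem exists_seq_testFunctions_tendsto {Ω : Set (Rn n)} (v : W0 n s p Ω) :
    ∃ t : ℕ → W0 n s p Ω, (∀ k, (t k : Wsp n s p) ∈ testFunctions n s p Ω) ∧
      Tendsto t atTop (𝓝 v) := by
  have hv : (v : Wsp n s p) ∈ closure (testFunctions n s p Ω : Set (Wsp n s p)) := by
    rw [← Submodule.topologicalClosure_coe]
    exact v.2
  obtain ⟨t, ht, htv⟩ := mem_closure_iff_seq_limit.1 hv
  exact ⟨fun k => ⟨t k, Submodule.le_topologicalClosure _ (ht k)⟩, ht, tendsto_subtype_rng.2 htv⟩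

/-- A weak solution may be tested with all functions of `W_0^{s,p}(Ω)`. -/
theorem isWeakSolution_iff (hpq : p.HolderConjugate q) {l L : ℝ} (hl : 0 ≤ l) {Ω : Set (Rn n)}
    {a : Rn n × Rn n → ℝ} (ha : a ∈ CoeffClass n l L) (f : StrongDual ℝ (W0 n s p Ω))
    (u : W0 n s p Ω) : IsWeakSolution a f u ↔ ∀ v : W0 n s p Ω,
      (1 / 2 : ℝ) * ∫ z, flux n s p a (wspFn u.1) z * nlGrad n s p (wspFn v.1) z = f v := by
  simp only [IsWeakSolution, weak_integrand_eq hpq.lt]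
  refine ⟨fun h v => ?_, fun h v _ => h v⟩
  obtain ⟨t, ht, htv⟩ := exists_seq_testFunctions_tendsto v
  have h1 := ((continuous_integral_mul_nlGrad hpq (memLp_flux hpq hl ha u.1)).tendsto v.1).comp
    (continuous_subtype_val.continuousAt.tendsto.comp htv)
  have h2 := (f.continuous.tendsto v).comp htv
  exact tendsto_nhds_unique (h1.const_mul (1 / 2 : ℝ)) (h2.congr fun k => (h (t k) (ht k)).symm)

theorem half_integral_flux_mul_nlGrad (a : Rn n × Rn n → ℝ) (u v : Wsp n s p) :
    (1 / 2 : ℝ) * ∫ z, flux n s p a (wspFn u) z * nlGrad n s p (wspFn v) z =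
      ∫ z, 2⁻¹ * a z * oddPow p (gradLp u z) * gradLp v z := by
  rw [← integral_const_mul]
  refine integral_congr_ae ?_
  filter_upwards [gradLp_ae u, gradLp_ae v] with z h1 h2
  rw [h1, h2, flux_eq]
  ring

-- The factor `1/2` and the coefficient are absorbed into the weight `2⁻¹ * a`, and Poincaré's
-- inequality supplies coercivity for the abstract existence result.
set_option maxHeartbeats 1000000 in
theorem exists_isWeakSolution (hpq : p.HolderConjugate q) (hn : 1 ≤ n) (hs0 : 0 < s)
    {l L : ℝ} (hl : 0 < l) {Ω : Set (Rn n)} (hΩ : Bornology.IsBounded Ω)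
    {a : Rn n × Rn n → ℝ} (ha : a ∈ CoeffClass n l L) (f : StrongDual ℝ (W0 n s p Ω)) :
    ∃ u : W0 n s p Ω, IsWeakSolution a f u := by
  have hp := hpq.lt
  have hp0 := hpq.pos
  obtain ⟨K, hK0, hK⟩ := exists_norm_le_mul_gradLp (s := s) (p := p) hn hs0 hΩ
  obtain ⟨S, K', hK'0, hK', hS⟩ := exists_weight_map (p := p) (half_pos hl)
    (a := fun z => 2⁻¹ * a z) ((aestronglyMeasurable_coeff ha).const_mul _)
    (L := 2⁻¹ * L) (by
      filter_upwards [ae_bounds_coeff ha] with z hz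
      constructor <;> linarith [hz.1, hz.2])
  obtain ⟨T, hT⟩ : ∃ T : Wsp n s p →L[ℝ] Lp ℝ (ENNReal.ofReal p)
      (volume : Measure (Rn n × Rn n)), ∀ v, T v = S (gradLp v) := ⟨S ∘L gradLp, fun _ => rfl⟩
  have hTK : ∀ v ∈ W0 n s p Ω, ‖v‖ ≤ K * K' * ‖T v‖ := fun v hv => by
    refine (hK v hv).trans ?_
    rw [mul_assoc, hT]
    exact mul_le_mul_of_nonneg_left (hK' _) hK0
  obtain ⟨u, hu⟩ := Submodule.exists_integral_oddPow_mul_eq (S := W0 n s p Ω) (isClosed_W0 Ω) hpq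
    T (mul_nonneg hK0 hK'0) hTK f
  refine ⟨u, (isWeakSolution_iff hpq hl.le ha f u).2 fun v => Eq.trans ?_ (hu v)⟩
  rw [half_integral_flux_mul_nlGrad, hT, hT, hS]

/-- Strong convergence from convergence of the monotone form. -/
theorem tendsto_gradLp_sub_of_monotone (hpq : p.HolderConjugate q) {l L : ℝ} (hl : 0 < l)
    {a : ℕ → Rn n × Rn n → ℝ} (ha : ∀ k, a k ∈ CoeffClass n l L) {u : ℕ → Wsp n s p}
    {u' : Wsp n s p} {R : ℝ} (hu : ∀ k, ‖gradLp (u k)‖ ≤ R)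
    (h : Tendsto (fun k => ∫ z, (flux n s p (a k) (wspFn (u k)) z -
      flux n s p (a k) (wspFn u') z) * nlGrad n s p (wspFn (u k - u')) z) atTop (𝓝 0)) :
    Tendsto (fun k => ‖gradLp (u k - u')‖ ^ p) atTop (𝓝 0) := by
  have hp := hpq.lt
  have hp0 := hpq.pos
  refine tendsto_zero_of_forall_le_mul_add (M := R ^ p + ‖gradLp u'‖ ^ p)
    (Eventually.of_forall fun k => by positivity) h fun ε hε => ?_
  obtain ⟨C, hC0, hC⟩ := exists_abs_sub_rpow_le_oddPow hp hε
  refine ⟨C / l, Eventually.of_forall fun k => ?_⟩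
  have h1 := integrable_abs_rpow hp (memLp_nlGrad (u k))
  have h2 := integrable_abs_rpow hp (memLp_nlGrad u')
  have h3 := integrable_mul_of_conj hpq ((memLp_flux hpq hl.le (ha k) (u k)).sub
    (memLp_flux hpq hl.le (ha k) u')) (memLp_nlGrad (u k - u'))
  simp only [Pi.sub_apply] at h3
  have h4 : Integrable (fun z => ε * (|nlGrad n s p (wspFn (u k)) z| ^ p +
      |nlGrad n s p (wspFn u') z| ^ p)) volume := (h1.add h2).const_mul ε
  calc ‖gradLp (u k - u')‖ ^ p
      = ∫ z, |nlGrad n s p (wspFn (u k - u')) z| ^ p := norm_gradLp_rpow _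
    _ ≤ ∫ z, (ε * (|nlGrad n s p (wspFn (u k)) z| ^ p + |nlGrad n s p (wspFn u') z| ^ p) +
        C / l * ((flux n s p (a k) (wspFn (u k)) z -
          flux n s p (a k) (wspFn u') z) * nlGrad n s p (wspFn (u k - u')) z)) := by
        refine integral_mono_ae (integrable_abs_rpow hp (memLp_nlGrad _))
          (h4.add (h3.const_mul (C / l))) ?_
        filter_upwards [nlGrad_sub_ae (u k) u', (ae_bounds_coeff (ha k))] with z hz hza
        simp only [hz, flux_eq]
        refine (hC _ _).trans ?_
        have h5 := oddPow_sub_mul_sub_nonneg hp (nlGrad n s p (wspFn (u k)) z)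
          (nlGrad n s p (wspFn u') z)
        rw [← mul_sub, mul_assoc]
        refine add_le_add_right ?_ _
        rw [div_mul_eq_mul_div, le_div_iff₀ hl, mul_assoc]
        refine mul_le_mul_of_nonneg_left ?_ hC0
        rw [mul_comm]
        exact mul_le_mul_of_nonneg_right hza.1 h5
    _ = ε * (‖gradLp (u k)‖ ^ p + ‖gradLp u'‖ ^ p) + C / l * ∫ z,
        (flux n s p (a k) (wspFn (u k)) z -
          flux n s p (a k) (wspFn u') z) * nlGrad n s p (wspFn (u k - u')) z := by
        rw [integral_add h4 (h3.const_mul (C / l)), integral_const_mul, integral_const_mul,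
          integral_add h1 h2, norm_gradLp_rpow, norm_gradLp_rpow]
    _ ≤ _ := by
        gcongr
        exact hu k

theorem tendsto_of_tendsto_gradLp_sub (hpq : p.HolderConjugate q) (hn : 1 ≤ n) (hs0 : 0 < s)
    {Ω : Set (Rn n)} (hΩ : Bornology.IsBounded Ω) {u : ℕ → W0 n s p Ω} {u' : W0 n s p Ω}
    (h : Tendsto (fun k => ‖gradLp ((u k).1 - u'.1)‖ ^ p) atTop (𝓝 0)) :
    Tendsto u atTop (𝓝 u') := by
  have hp0 := hpq.pos
  obtain ⟨K, hK0, hK⟩ := exists_norm_le_mul_gradLp (s := s) (p := p) hn hs0 hΩ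
  refine tendsto_subtype_rng.2 (tendsto_iff_norm_sub_tendsto_zero.2 ?_)
  have h1 := (h.rpow_const (p := 1 / p) (Or.inr (by positivity))).const_mul K
  rw [Real.zero_rpow (one_div_ne_zero hp0.ne'), mul_zero] at h1
  refine squeeze_zero (fun _ => norm_nonneg _) (fun k => ?_) h1
  rw [← Real.rpow_mul (norm_nonneg _), mul_one_div_cancel hp0.ne', Real.rpow_one]
  exact hK _ (sub_mem (u k).2 u'.2)

/-- For two solutions the monotone form is zero; applied to constant sequences, the strong
convergence result identifies them. -/
theorem isTheSolution_of_isWeakSolution (hpq : p.HolderConjugate q) (hn : 1 ≤ n) (hs0 : 0 < s)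
    {l L : ℝ} (hl : 0 < l) {Ω : Set (Rn n)} (hΩ : Bornology.IsBounded Ω)
    {a : Rn n × Rn n → ℝ} (ha : a ∈ CoeffClass n l L) {f : StrongDual ℝ (W0 n s p Ω)}
    {u : W0 n s p Ω} (hu : IsWeakSolution a f u) : IsTheSolution a f u := by
  refine fun w => ⟨fun hw => ?_, fun h => h ▸ hu⟩
  rw [isWeakSolution_iff hpq hl.le ha] at hu hw
  have h1 := tendsto_gradLp_sub_of_monotone hpq hl (a := fun _ => a) (fun _ => ha)
    (u := fun _ => w.1) (u' := u.1) (fun _ => le_rfl) (by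
      have h2 := (hw (w - u)).trans (hu (w - u)).symm
      have h3 := integrable_mul_of_conj hpq (memLp_flux hpq hl.le ha w.1)
        (memLp_nlGrad (w.1 - u.1))
      have h4 := integrable_mul_of_conj hpq (memLp_flux hpq hl.le ha u.1)
        (memLp_nlGrad (w.1 - u.1))
      simp only [sub_mul]
      rw [integral_sub h3 h4]
      have h5 : ∫ z, flux n s p a (wspFn w.1) z * nlGrad n s p (wspFn (w.1 - u.1)) z =
          ∫ z, flux n s p a (wspFn u.1) z * nlGrad n s p (wspFn (w.1 - u.1)) z :=
        mul_left_cancel₀ (by norm_num) h2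
      rw [sub_eq_zero.2 h5]
      exact tendsto_const_nhds)
  exact tendsto_nhds_unique (tendsto_const_nhds (x := w))
    (tendsto_of_tendsto_gradLp_sub hpq hn hs0 hΩ (u := fun _ => w) h1)

-- Testing with `u` itself gives `l g ^ p ≤ 2 F K g` for `g = ‖gradLp u‖`. The bound is independent
-- of the coefficient, hence uniform along the sequence.
set_option maxHeartbeats 1000000 in
theorem exists_bound_gradLp (hpq : p.HolderConjugate q) (hn : 1 ≤ n) (hs0 : 0 < s)
    {l L : ℝ} (hl : 0 < l) {Ω : Set (Rn n)} (hΩ : Bornology.IsBounded Ω)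
    (f : StrongDual ℝ (W0 n s p Ω)) : ∃ R : ℝ, ∀ a ∈ CoeffClass n l L, ∀ u : W0 n s p Ω,
      IsWeakSolution a f u → ‖gradLp u.1‖ ≤ R := by
  have hp := hpq.lt
  obtain ⟨K, hK0, hK⟩ := exists_norm_le_mul_gradLp (s := s) (p := p) hn hs0 hΩ
  obtain ⟨F, hF0, hF⟩ := Submodule.exists_abs_dual_le (W0 n s p Ω) f
  refine ⟨(2 * F * K / l) ^ (p - 1)⁻¹, fun a ha u hu => ?_⟩
  set g := ‖gradLp u.1‖ with hg
  have hg0 : 0 ≤ g := norm_nonneg _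
  rw [isWeakSolution_iff hpq hl.le ha] at hu
  have h1 : l * g ^ p ≤ ∫ z, flux n s p a (wspFn u.1) z * nlGrad n s p (wspFn u.1) z := by
    rw [hg, norm_gradLp_rpow, ← integral_const_mul]
    refine integral_mono_ae ((integrable_abs_rpow hp (memLp_nlGrad u.1)).const_mul l)
      (integrable_mul_of_conj hpq (memLp_flux hpq hl.le ha u.1) (memLp_nlGrad u.1)) ?_
    filter_upwards [(ae_bounds_coeff ha)] with z hz
    rw [flux_eq, mul_assoc, oddPow_mul_self hp]
    exact mul_le_mul_of_nonneg_right hz.1 (by positivity)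
  have h2 : f u ≤ F * (K * g) := by
    refine (le_abs_self _).trans ((hF u).trans ?_)
    gcongr
    exact hK _ u.2
  have h3 : l * g ^ p ≤ 2 * (F * (K * g)) := by
    have := hu u
    linarith
  rcases hg0.eq_or_lt with h0 | h0
  · rw [← h0]
    positivity
  · rw [Real.le_rpow_inv_iff_of_pos hg0 (by positivity) (by linarith), le_div_iff₀ hl]
    have h4 : g ^ p = g ^ (p - 1) * g := by rw [← Real.rpow_add_one h0.ne', sub_add_cancel]
    rw [h4] at h3
    refine le_of_mul_le_mul_right ?_ h0
    linarith

end Equation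

/-! ### From weak-* convergence of coefficients to `H`-convergence. -/

section HConvergence

variable {n : ℕ} {s p : ℝ}

/-- Testing with the indicator of a set and with its reflection gives the same integrals of `a k`,
so the limits agree. -/
theorem ae_eq_swap_of_weakStar {l L : ℝ} {a : ℕ → Rn n × Rn n → ℝ} {a' : Rn n × Rn n → ℝ}
    (ha : ∀ k, a k ∈ CoeffClass n l L) (ha'm : AEStronglyMeasurable a' volume)
    (ha'b : ∀ᵐ z, l ≤ a' z ∧ a' z ≤ L)
    (h : ∀ g : Rn n × Rn n → ℝ, Integrable g volume →
      Tendsto (fun k => ∫ z, a k z * g z) atTop (𝓝 (∫ z, a' z * g z))) :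
    ∀ᵐ z, a' z = a' z.swap := by
  have hswap : MeasurePreserving (Prod.swap : Rn n × Rn n → Rn n × Rn n) volume volume :=
    Measure.measurePreserving_swap
  have ha's : AEStronglyMeasurable (fun z : Rn n × Rn n => a' z.swap) volume :=
    ha'm.comp_measurePreserving hswap
  have ha'sb : ∀ᵐ z : Rn n × Rn n, l ≤ a' z.swap ∧ a' z.swap ≤ L :=
    hswap.quasiMeasurePreserving.ae ha'b
  have hind : ∀ (b : Rn n × Rn n → ℝ) {S : Set (Rn n × Rn n)}, MeasurableSet S →
      ∫ z, b z * S.indicator 1 z = ∫ z in S, b z := fun b S hS => by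
    rw [← integral_indicator hS]
    congr 1 with z
    by_cases hz : z ∈ S <;> simp [hz]
  have h1 : ∀ S : Set (Rn n × Rn n), volume S < ⊤ → MeasurableSet S →
      Integrable (S.indicator (1 : Rn n × Rn n → ℝ)) volume := fun S hSf hS =>
    (integrable_indicator_iff hS).2 (integrableOn_const (C := (1 : ℝ)) hSf.ne)
  refine ae_eq_of_forall_setIntegral_eq_of_sigmaFinite (fun S hS hSf => ?_)
    (fun S hS hSf => ?_) fun S hS hSf => ?_
  · have := integrable_mul_of_ae_bounds ha'm ha'b (h1 S hSf hS)
    rw [← integrable_indicator_iff hS]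
    refine this.congr (Eventually.of_forall fun z => ?_)
    by_cases hz : z ∈ S <;> simp [hz]
  · have := integrable_mul_of_ae_bounds ha's ha'sb (h1 S hSf hS)
    rw [← integrable_indicator_iff hS]
    refine this.congr (Eventually.of_forall fun z => ?_)
    by_cases hz : z ∈ S <;> simp [hz]
  · have h2 := h _ (h1 S hSf hS)
    have h3 := h (fun z : Rn n × Rn n => S.indicator 1 z.swap)
      (hswap.integrable_comp_of_integrable (h1 S hSf hS))
    rw [← hind _ hS, ← hind _ hS]
    have h4 : ∀ b : Rn n × Rn n → ℝ, ∫ z : Rn n × Rn n, b z * S.indicator 1 z.swap =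
        ∫ z : Rn n × Rn n, b z.swap * S.indicator 1 z := fun b => by
      have h5 := integral_prod_swap (μ := (volume : Measure (Rn n)))
        (ν := (volume : Measure (Rn n)))
        (fun z : Rn n × Rn n => b z.swap * S.indicator (1 : Rn n × Rn n → ℝ) z)
      simp only [Prod.swap_swap] at h5
      exact h5
    rw [h4] at h3
    refine tendsto_nhds_unique h2 (h3.congr fun k => ?_)
    rw [h4]
    refine integral_congr_ae ?_
    filter_upwards [(ha k).2.1] with z hz
    rw [hz]

theorem WeakConvConj.of_univ {G : Set (Rn n × Rn n)} (hG : MeasurableSet G)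
    {Q : ℕ → Rn n × Rn n → ℝ} {Q' : Rn n × Rn n → ℝ} (h : WeakConvConj p Set.univ Q Q') :
    WeakConvConj p G Q Q' := by
  obtain ⟨h1, h2, h3⟩ := h
  simp only [Measure.restrict_univ] at h1 h2 h3
  refine ⟨fun k => (h1 k).restrict G, h2.restrict G, fun g hg => ?_⟩
  have h4 := h3 (G.indicator g) ((memLp_indicator_iff_restrict hG).2 hg)
  have h5 : ∀ b : Rn n × Rn n → ℝ, ∫ z, b z * G.indicator g z = ∫ z in G, b z * g z := fun b => by
    rw [← integral_indicator hG]
    congr 1 with z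
    by_cases hz : z ∈ G <;> simp [hz]
  simpa only [h5] using h4

variable [Fact (1 < p)]

set_option maxHeartbeats 1000000 in
/-- Weak-* convergence of the coefficients implies `H`-convergence, with strong convergence of the
states and weak convergence of the fluxes on the whole space. -/
theorem hConvergesOn_univ_of_weakStar (hn : 1 ≤ n) (hs0 : 0 < s) {Ω : Set (Rn n)}
    (hΩ : Bornology.IsBounded Ω) {l L : ℝ} (hl : 0 < l) {a : ℕ → Rn n × Rn n → ℝ}
    {a' : Rn n × Rn n → ℝ} (ha : ∀ k, a k ∈ CoeffClass n l L) (ha' : a' ∈ CoeffClass n l L)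
    (h : ∀ g : Rn n × Rn n → ℝ, Integrable g volume →
      Tendsto (fun k => ∫ z, a k z * g z) atTop (𝓝 (∫ z, a' z * g z))) :
    HConvergesOn n s p Ω Set.univ a a' := by
  intro f
  have hpq : p.HolderConjugate (p / (p - 1)) := Real.HolderConjugate.conjExponent Fact.out
  set q := p / (p - 1) with hq
  have hp0 := hpq.pos
  have hq0 := hpq.symm.pos
  choose u hu using fun k => exists_isWeakSolution hpq hn hs0 hl hΩ (ha k) f
  obtain ⟨u', hu'⟩ := exists_isWeakSolution hpq hn hs0 hl hΩ ha' f
  obtain ⟨R, hR⟩ := exists_bound_gradLp (L := L) hpq hn hs0 hl hΩ f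
  have huR : ∀ k, ‖gradLp (u k).1‖ ≤ R := fun k => hR _ (ha k) _ (hu k)
  have hu'R : ‖gradLp u'.1‖ ≤ R := hR _ ha' _ hu'
  obtain ⟨K, hK0, hK⟩ := exists_norm_le_mul_gradLp (s := s) (p := p) hn hs0 hΩ
  have heR : ∀ k, ‖(u k).1 - u'.1‖ ≤ K * (R + R) := fun k => by
    refine (hK _ (sub_mem (u k).2 u'.2)).trans ?_
    gcongr
    rw [map_sub]
    exact (norm_sub_le _ _).trans (add_le_add (huR k) hu'R)
  have hJ' := memLp_oddPow hpq (memLp_nlGrad u'.1)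
  have hL0 : 0 ≤ L := by
    obtain ⟨z, hz⟩ := (ae_bounds_coeff ha').exists
    exact hl.le.trans (hz.1.trans hz.2)
  -- The fixed factor is `J(D u') ∈ L^q`, and the bounded sequence is `u_k - u'`: no convergence of
  -- `u_k` is needed beforehand.
  have hcc := tendsto_integral_mul_nlGrad hpq hs0 (b := fun k z => a k z - a' z)
    (M := L + L) (by linarith)
    (fun k => (aestronglyMeasurable_coeff (ha k)).sub (aestronglyMeasurable_coeff ha'))
    (fun k => by
      filter_upwards [(ae_bounds_coeff (ha k)), (ae_bounds_coeff ha')] with z h1 h2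
      rw [abs_le]
      constructor <;> linarith)
    (fun g hg => by
      have h1 := (h g hg).sub_const (∫ z, a' z * g z)
      rw [sub_self] at h1
      refine h1.congr fun k => ?_
      rw [← integral_sub (integrable_mul_of_ae_bounds (aestronglyMeasurable_coeff (ha k))
        (ae_bounds_coeff (ha k)) hg) (integrable_mul_of_ae_bounds (aestronglyMeasurable_coeff ha')
        (ae_bounds_coeff ha') hg)]
      simp only [sub_mul])
    hJ' (fun k => (u k).1 - u'.1) heR
  have hmono : Tendsto (fun k => ∫ z, (flux n s p (a k) (wspFn (u k).1) z -
      flux n s p (a k) (wspFn u'.1) z) * nlGrad n s p (wspFn ((u k).1 - u'.1)) z) atTop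
      (𝓝 0) := by
    have h0 := hcc.neg
    rw [neg_zero] at h0
    refine h0.congr fun k => ?_
    have h1 := (isWeakSolution_iff hpq hl.le (ha k) f _).1 (hu k) (u k - u')
    have h2 := (isWeakSolution_iff hpq hl.le ha' f _).1 hu' (u k - u')
    -- Both problems have the same right side `f`, so the two flux integrals against `D(u_k - u')`
    -- coincide; this exchanges the unknown flux for that of `u'`.
    have h3 := mul_left_cancel₀ (by norm_num) (h1.trans h2.symm)
    have hD := memLp_nlGrad ((u k).1 - u'.1)
    have i1 := integrable_mul_of_conj hpq (memLp_flux hpq hl.le (ha k) (u k).1) hD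
    have i2 := integrable_mul_of_conj hpq (memLp_flux hpq hl.le (ha k) u'.1) hD
    have i3 := integrable_mul_of_conj hpq (memLp_flux hpq hl.le ha' u'.1) hD
    simp only [sub_mul]
    rw [integral_sub i1 i2]
    have h4 : ∫ z, (a k z * oddPow p (nlGrad n s p (wspFn u'.1) z) *
          nlGrad n s p (wspFn ((u k).1 - u'.1)) z -
        a' z * oddPow p (nlGrad n s p (wspFn u'.1) z) *
          nlGrad n s p (wspFn ((u k).1 - u'.1)) z) =
        (∫ z, flux n s p (a k) (wspFn u'.1) z * nlGrad n s p (wspFn ((u k).1 - u'.1)) z) -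
        ∫ z, flux n s p a' (wspFn u'.1) z * nlGrad n s p (wspFn ((u k).1 - u'.1)) z := by
      rw [← integral_sub i2 i3]
      simp only [flux_eq]
    rw [h4]
    have h5 : ∫ z, flux n s p (a k) (wspFn (u k).1) z *
        nlGrad n s p (wspFn ((u k).1 - u'.1)) z = ∫ z, flux n s p a' (wspFn u'.1) z *
        nlGrad n s p (wspFn ((u k).1 - u'.1)) z := h3
    rw [h5]
    ring
  have hgrad := tendsto_gradLp_sub_of_monotone hpq hl ha huR hmono
  have hstrong : Tendsto u atTop (𝓝 u') := tendsto_of_tendsto_gradLp_sub hpq hn hs0 hΩ hgrad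
  refine ⟨u, u', fun k => isTheSolution_of_isWeakSolution hpq hn hs0 hl hΩ (ha k) (hu k),
    isTheSolution_of_isWeakSolution hpq hn hs0 hl hΩ ha' hu',
    fun ℓ => (ℓ.continuous.tendsto u').comp hstrong, ?_⟩
  simp only [WeakConvConj, Measure.restrict_univ]
  refine ⟨fun k => memLp_flux hpq hl.le (ha k) _, memLp_flux hpq hl.le ha' _, fun g hg => ?_⟩
  have hJ : ∀ k, MemLp (fun z => oddPow p (nlGrad n s p (wspFn (u k).1) z) -
      oddPow p (nlGrad n s p (wspFn u'.1) z)) (ENNReal.ofReal q) volume := fun k =>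
    (memLp_oddPow hpq (memLp_nlGrad (u k).1)).sub hJ'
  have h1 : Tendsto (fun k => ∫ z, |oddPow p (nlGrad n s p (wspFn (u k).1) z) -
      oddPow p (nlGrad n s p (wspFn u'.1) z)| ^ q) atTop (𝓝 0) := by
    refine tendsto_integral_abs_oddPow_sub_rpow hpq (M := R ^ p)
      (fun k => memLp_nlGrad (u k).1) (memLp_nlGrad u'.1) (Eventually.of_forall fun k => ?_) ?_
    · rw [← norm_gradLp_rpow]
      exact Real.rpow_le_rpow (norm_nonneg _) (huR k) hp0.le
    · refine hgrad.congr fun k => ?_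
      rw [norm_gradLp_rpow]
      refine integral_congr_ae ?_
      filter_upwards [nlGrad_sub_ae (u k).1 u'.1] with z hz
      rw [hz]
  have h2 : Tendsto (fun k => ∫ z, |a k z * (oddPow p (nlGrad n s p (wspFn (u k).1) z) -
      oddPow p (nlGrad n s p (wspFn u'.1) z))| ^ q) atTop (𝓝 0) := by
    have h3 := h1.const_mul (L ^ q)
    rw [mul_zero] at h3
    refine squeeze_zero (fun k => integral_nonneg fun z => by positivity) (fun k => ?_) h3
    rw [← integral_const_mul]
    refine integral_mono_ae (integrable_abs_rpow hpq.symm.lt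
      (memLp_coeff_mul hl.le (ha k) (hJ k)))
      ((integrable_abs_rpow hpq.symm.lt (hJ k)).const_mul _) ?_
    filter_upwards [(ae_bounds_coeff (ha k))] with z hz
    have h4 : 0 ≤ a k z := hl.le.trans hz.1
    rw [abs_mul, abs_of_nonneg h4, Real.mul_rpow h4 (abs_nonneg _)]
    gcongr
    exact hz.2
  have h3 := tendsto_integral_mul_of_tendsto_rpow hpq
    (fun k => memLp_coeff_mul hl.le (ha k) (hJ k)) hg h2
  have hint := integrable_mul_of_conj hpq hJ' hg
  -- The weak-* limit is tested with `J(D u') g`, integrable by Hölder's inequality.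
  have h4 := h3.add (h _ hint)
  rw [zero_add] at h4
  convert! h4 using 2
  · rename_i k
    rw [← integral_add (integrable_mul_of_conj hpq
      (memLp_coeff_mul hl.le (ha k) (hJ k)) hg) (integrable_mul_of_ae_bounds
      (aestronglyMeasurable_coeff (ha k)) (ae_bounds_coeff (ha k)) hint)]
    congr 1 with z
    rw [flux_eq]
    ring
  · congr 1 with z
    rw [flux_eq]
    ring

end HConvergence

theorem mainTheorem3 (n : ℕ) (hn : 1 ≤ n) (s p : ℝ) (hs0 : 0 < s) (hs1 : s < 1) [Fact (1 < p)]
    (Ω : Set (Rn n)) (hΩo : IsOpen Ω) (hΩb : Bornology.IsBounded Ω)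
    (l L : ℝ) (hl : 0 < l) (hlL : l ≤ L)
    (a : ℕ → Rn n × Rn n → ℝ) (ha : ∀ k, a k ∈ CoeffClass n l L) :
    ∃ φ : ℕ → ℕ, StrictMono φ ∧ ∃ a' ∈ CoeffClass n l L,
      HConverges n s p Ω (fun k => a (φ k)) a' ∧
      HConvergesOn n s p Ω Set.univ (fun k => a (φ k)) a' := by
  obtain ⟨φ, hφ, a', ha'm, ha'b, hlim⟩ := exists_subseq_weakStar a
    (fun k => (aestronglyMeasurable_coeff (ha k))) (fun k => (ae_bounds_coeff (ha k)))
  have ha' : a' ∈ CoeffClass n l L := by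
    refine ⟨memLp_top_of_bound ha'm L ?_,
      ae_eq_swap_of_weakStar (fun k => ha (φ k)) ha'm ha'b hlim, ha'b⟩
    filter_upwards [ha'b] with z hz
    rw [Real.norm_of_nonneg (hl.le.trans hz.1)]
    exact hz.2
  have hH : HConvergesOn n s p Ω Set.univ (fun k => a (φ k)) a' :=
    hConvergesOn_univ_of_weakStar hn hs0 hΩb hl (fun k => ha (φ k)) ha' hlim
  refine ⟨φ, hφ, a', ha', fun f => ?_, hH⟩
  obtain ⟨u, u', h1, h2, h3, h4⟩ := hH f
  exact ⟨u, u', h1, h2, h3, h4.of_univ (hΩo.measurableSet.prod hΩo.measurableSet)⟩
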